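/- Conventions. An algorithm is a deterministic multi-tape Turing machine. A time-complexity class $\mathcal C$ is given by a family $\mathcal F$ of non-decreasing functions $f:\mathbb N\to\mathbb N$ with $f(n)\ge n$, closed under $f\mapsto \bigl(n\mapsto C f(Cn+C)+C\bigr)$ for every integer $C\ge 1$; a language $L$ over a finite alphabet $X$ is in $\mathcal C$ if for some $f\in\mathcal F$ some machine decides $L$ in at most $f(|w|)$ steps on every $w\in X^*$. A function $f:\mathbb N\to[0,\infty)$ is subexponential if $f(n)/r^n\to 0$ for every $r>1$; $\mathrm{SubExp}$ is the class of languages decidable in time bounded by a subexponential function. A finite generating set of a group $G$ is a finite set $A$ with a map $\pi:A\to G$ whose image generates $G$; the word problem of $G$ relative to $A$ is the language $WP(G,A)\subseteq (A\cup A^{-1})^*$ of all words representing $1\in G$. The word problem of $G$ is in a class if $WP(G,A)$ is in it for some finite generating set $A$. For $v$ in the free group $F(A)$, $|v|$ is the length of the freely reduced word representing $v$. A discrete probability measure $\mu:F(A)\to[0,1]$ is length-invariant if $\mu(u)=\mu(v)$ whenever $|u|=|v|$. Theorem E. Let $G$ be a finitely presented group whose word problem is in $\mathrm{SubExp}$,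 and let $\mathcal C\subseteq\mathrm{SubExp}$ be a time-complexity class given by the family $\mathcal F$. Suppose that $G$ has a subgroup of finite index which possesses a non-amenable quotient group $\bar G$ whose word problem is in $\mathcal C$. Then for every finite generating set $A$ of $G$ the word problem of $G$, with elements of $F(A)$ as inputs, is solvable with average-case time-complexity in $\mathcal C$, uniformly relative to the family of all length-invariant discrete probability measures on $F(A)$. That is, there are a machine $M$ that decides $WP(G,A)$, a positive function $f\in\mathcal F$ and a constant $0<K<\infty$ such that for every length-invariant discrete probability measure $\mu$ on $F(A)$ $$\sum_{v\in F(A)}\frac{T(v)}{f(|v|)}\,\mu(v)\le K,$$ where $T(v)$ is the number of steps of $M$ on the freely reduced word representing $v$. -/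

import Mathlib

open scoped NNReal ENNReal symmDiff

/-! ### Deterministic multi-tape Turing machines -/

/-- A deterministic multi-tape Turing machine that accepts or rejects words over `X`.
It has one input tape (index `none`) and finitely many work tapes (indices `some w`). In one step
it reads the scanned symbol on every tape and, depending on these and on its state, passes to a new
state or halts with a verdict, writes one symbol on every tape, and moves every head by at most one
cell. The tapes are unbounded in both directions; `default : Symbol` is the blank. -/
structure MultiTapeTM (X : Type*) where
  /-- the index set of the work tapes -/
  Work : Type
  /-- the tape alphabet -/
  Symbol : Type
  /-- the non-halting states -/
  State : Type
  finiteWork : Finite Work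
  finiteSymbol : Finite Symbol
  finiteState : Finite State
  inhabitedSymbol : Inhabited Symbol
  /-- the initial state -/
  start : State
  /-- input letters as tape symbols -/
  letter : X ↪ Symbol
  letter_ne_blank : ∀ x, letter x ≠ default
  /-- the transition function; the verdict `true` means accept, `false` means reject,
  and the movement `none` means that the head stays where it is -/
  δ : State → (Option Work → Symbol) →
    (State ⊕ Bool) × (Option Work → Symbol × Option Turing.Dir)

attribute [instance] MultiTapeTM.inhabitedSymbol

namespace MultiTapeTM

variable {X : Type*} (M : MultiTapeTM X)

/-- A configuration: a state or a verdict, together with the contents and head positions of the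
tapes. -/
structure Cfg where
  status : M.State ⊕ Bool
  tape : Option M.Work → Turing.Tape M.Symbol

/-- The initial configuration on the input `w`: the word `w` is written on the input tape with the
head on its first letter, and the work tapes are blank. -/
def init (w : List X) : M.Cfg where
  status := Sum.inl M.start
  tape
    | none => Turing.Tape.mk₁ (w.map M.letter)
    | some _ => Turing.Tape.mk₁ []

/-- Write a symbol on a tape, then move the head. -/
def act (T : Turing.Tape M.Symbol) (a : M.Symbol × Option Turing.Dir) : Turing.Tape M.Symbol :=
  match a.2 with
  | none => T.write a.1
  | some d => (T.write a.1).move d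

/-- One step of the machine; a halted configuration does not change any more. -/
def step (c : M.Cfg) : M.Cfg :=
  match c.status with
  | Sum.inr _ => c
  | Sum.inl q =>
    let r := M.δ q fun i => (c.tape i).head
    { status := r.1, tape := fun i => M.act (c.tape i) (r.2 i) }

/-- The configuration after `t` steps on the input `w`. -/
def run (w : List X) (t : ℕ) : M.Cfg := M.step^[t] (M.init w)

/-- On the input `w` the machine has halted with the verdict `b` after at most `t` steps. -/
def HaltsWith (w : List X) (b : Bool) (t : ℕ) : Prop := (M.run w t).status = Sum.inr b

/-- The running time on the input `w`: the number of steps until the machine halts, and `⊤` if it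
never halts. -/
noncomputable def time (w : List X) : ℕ∞ :=
  ⨅ (t : ℕ) (_ : ∃ b, M.HaltsWith w b t), (t : ℕ∞)

/-- The machine halts on every word, accepting the words of `L` and rejecting all others. -/
def Decides (L : Language X) : Prop :=
  ∀ w : List X, (w ∈ L → ∃ t, M.HaltsWith w true t) ∧ (w ∉ L → ∃ t, M.HaltsWith w false t)

end MultiTapeTM

/-! ### Complexity classes -/

/-- A class of languages: a set of languages over each alphabet. -/
abbrev LanguageClass := ∀ X : Type, Set (Language X)

/-- The constraint families of time-complexity classes: families of non-decreasing functions
`f n ≥ n`, closed under `f ↦ C * f (C * n + C) + C` for all integers `C ≥ 1`. -/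
structure IsTimeFamily (𝓕 : Set (ℕ → ℕ)) : Prop where
  monotone : ∀ f ∈ 𝓕, Monotone f
  le_self : ∀ f ∈ 𝓕, ∀ n, n ≤ f n
  closed : ∀ f ∈ 𝓕, ∀ C : ℕ, 1 ≤ C → (fun n => C * f (C * n + C) + C) ∈ 𝓕

/-- The languages decidable in time bounded by a member of `𝓕`. -/
def DTime (𝓕 : Set (ℕ → ℕ)) : LanguageClass := fun X =>
  {L | ∃ f ∈ 𝓕, ∃ M : MultiTapeTM X, M.Decides L ∧ ∀ w, M.time w ≤ (f w.length : ℕ∞)}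

/-- `f` is subexponential: `f n / r ^ n → 0` for every `r > 1`. -/
def IsSubexponential (f : ℕ → ℝ≥0) : Prop :=
  ∀ r : ℝ, 1 < r → Filter.Tendsto (fun n => (f n : ℝ) / r ^ n) Filter.atTop (nhds 0)

/-- The languages decidable in deterministic subexponential time. -/
def SubExp : LanguageClass := fun X =>
  {L | ∃ f : ℕ → ℝ≥0, IsSubexponential f ∧
    ∃ M : MultiTapeTM X, M.Decides L ∧ ∀ w, (M.time w : ℝ≥0∞) ≤ (f w.length : ℝ≥0∞)}

/-! ### Groups -/

/-- The letters of the family `π`, which may repeat elements, generate `G`. -/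
def IsGeneratingFamily {A G : Type*} [Group G] (π : A → G) : Prop :=
  Subgroup.closure (Set.range π) = ⊤

/-- The word problem of `G` relative to `π : A → G`: all words in the letters of `A` and their
formal inverses, `(a, true)` standing for `a` and `(a, false)` for the inverse of `a`, which
represent the identity. -/
def wordProblem {A G : Type*} [Group G] (π : A → G) : Language (A × Bool) :=
  {w | FreeGroup.lift π (FreeGroup.mk w) = 1}

/-- `G` has a finite generating family relative to which its word problem belongs to `𝒞`. -/
def HasWordProblemIn (G : Type*) [Group G] (𝒞 : LanguageClass) : Prop :=
  ∃ (n : ℕ) (π : Fin n → G), IsGeneratingFamily π ∧ wordProblem π ∈ 𝒞 (Fin n × Bool)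

open Classical in
/-- Amenability of a discrete group, as the Følner condition: for every finite set `S` of elements
and every `ε > 0` there is a finite non-empty set `F` that every right translation by an element of
`S` moves by at most the proportion `ε`. -/
def IsAmenableGroup (G : Type*) [Group G] : Prop :=
  ∀ (S : Finset G) (ε : ℝ), 0 < ε → ∃ F : Finset G, F.Nonempty ∧
    ∀ s ∈ S, (((F.image (· * s)) ∆ F).card : ℝ) ≤ ε * (F.card : ℝ)

/-! ### Average-case complexity with inputs from a free group -/

/-- A discrete probability measure on the free group is length-invariant if elements with equally
long reduced words have the same probability. -/
def IsLengthInvariant {A : Type*} [DecidableEq A] (μ : PMF (FreeGroup A)) : Prop :=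
  ∀ u v : FreeGroup A, u.norm = v.norm → μ u = μ v

/-- The machine `M` solves `L` with average-case time-complexity bounded by the positive
non-decreasing function `f`, uniformly relative to the family `R` of discrete probability measures
on the free group, whose elements are given to `M` as reduced words. -/
def MultiTapeTM.SolvesOnAverage {A : Type*} [DecidableEq A] (M : MultiTapeTM (A × Bool))
    (L : Language (A × Bool)) (f : ℕ → ℕ) (R : Set (PMF (FreeGroup A))) : Prop :=
  M.Decides L ∧ Monotone f ∧ (∀ n, 0 < f n) ∧
    ∃ K : ℝ≥0, 0 < K ∧ ∀ μ ∈ R,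
      ∑' v : FreeGroup A, (M.time v.toWord : ℝ≥0∞) / (f v.norm : ℝ≥0∞) * μ v ≤ (K : ℝ≥0∞)

/-! ### Doubling injections of non-amenable groups -/

/-! A word representing the identity of `G` fixes every point of every `G`-set. The `G`-set used
here is induced from `H` acting on `Q` through `φ`: it is fibred over `G ⧸ H` with fibre `Q`, and
`G` acts transitively. Whether a word fixes the base point can be tested cheaply: a finite automaton
follows the coset while writing a word of linear length in the generators of `Q`, and the word
problem of `Q` does the rest. A word that moves the base point is rejected at once. Only the others
are passed on, rewritten with linear length, to the subexponential algorithm for `G`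
(`exists_decides_wordProblem`).

It remains to see that the slow case is rare. If the words fixing the base point have proportion at
most `C * r ^ n` in the sphere of radius `n`, with `r < 1`, this beats the subexponential cost,
which is at most `K * r⁻¹ ^ n` (`IsSubexponential.exists_le_mul_pow`). A length-invariant measure is
a mixture of uniform measures on spheres, so one bound serves all of them
(`tsum_mul_le_of_isLengthInvariant`).

The rarity (`exists_card_stabilizer_le`) is a cogrowth estimate in four steps. Failure of the Følner
condition and Hall's marriage theorem give an injection of two copies of `Q` into `Q` by boundedly
many right translations, and it lifts to the induced space. Such a doubling is incompatible with
almost invariant vectors in `ℓ²`, so the lazy adjacency operator has norm below its degree. The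
Green function at a value between the norm and the degree is a positive function `u` whose neighbour
sum is at most `l * u`, with `l` less than the number `q + 1` of signed letters. Finally `u (s • x)
- t * u x`, for `t` slightly above `1 / q`, is a positive supersolution for walks without
backtracking, with factor `t⁻¹ < q`. It bounds the returning reduced words by a multiple of `t⁻¹ ^
n`, whereas all reduced words number at least `q ^ n`. -/

open Classical in
theorem exists_finset_card_mul_ge {Q : Type*} [Group Q] (hQ : ¬ IsAmenableGroup Q) :
    ∃ (T : Finset Q) (r : ℝ), 1 < r ∧
      ∀ F : Finset Q, r * F.card ≤ ((Finset.image₂ (· * ·) F T).card : ℝ) := by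
  unfold IsAmenableGroup at hQ
  push Not at hQ
  obtain ⟨S, ε, hε, hS⟩ := hQ
  refine ⟨insert 1 S, 1 + ε / 2, by linarith, fun F => ?_⟩
  rcases F.eq_empty_or_nonempty with rfl | hF
  · simp
  obtain ⟨s, hs, hlt⟩ := hS F hF
  have hcard : (F.image (· * s)).card = F.card :=
    Finset.card_image_of_injective _ (mul_left_injective s)
  have hsymm : ((F.image (· * s)) ∆ F).card
      = (F.image (· * s) \ F).card + (F \ F.image (· * s)).card := by
    rw [← Finset.card_union_of_disjoint]
    · rfl
    · exact disjoint_sdiff_sdiff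
  have hsub : F.image (· * s) ∪ F ⊆ Finset.image₂ (· * ·) F (insert 1 S) := by
    intro x hx
    rcases Finset.mem_union.1 hx with hx | hx
    · obtain ⟨y, hy, rfl⟩ := Finset.mem_image.1 hx
      exact Finset.mem_image₂_of_mem hy (Finset.mem_insert_of_mem hs)
    · simpa using Finset.mem_image₂_of_mem (f := (· * ·)) hx (Finset.mem_insert_self 1 S)
  have h1 := Finset.card_le_card hsub
  have h2 := Finset.card_sdiff_add_card (F.image (· * s)) F
  have h3 := Finset.card_sdiff_add_card F (F.image (· * s))
  rw [Finset.union_comm] at h3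
  -- Both sets have the same cardinality, so the two halves of the symmetric difference are equally
  -- large; this is the origin of `ε / 2`.
  have h4 : ((F.image (· * s)) ∆ F).card = 2 * (F.image (· * s) \ F).card := by omega
  have h5 : F.card + (F.image (· * s) \ F).card
    ≤ (Finset.image₂ (· * ·) F (insert 1 S)).card := by omega
  have h6 : (F.card : ℝ) + (F.image (· * s) \ F).card
    ≤ (Finset.image₂ (· * ·) F (insert 1 S)).card := by exact_mod_cast h5
  have h7 : (((F.image (· * s)) ∆ F).card : ℝ) = 2 * (F.image (· * s) \ F).card := by
    exact_mod_cast h4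
  linarith

open Classical in
theorem exists_finset_two_mul_card_le {Q : Type*} [Group Q] (hQ : ¬ IsAmenableGroup Q) :
    ∃ T : Finset Q, ∀ F : Finset Q, 2 * F.card ≤ (Finset.image₂ (· * ·) F T).card := by
  obtain ⟨T, r, hr, hT⟩ := exists_finset_card_mul_ge hQ
  -- Expansion is multiplicative: `n` successive products with `T` expand by `r ^ n`, which
  -- eventually exceeds 2.
  have key : ∀ n : ℕ, ∃ T' : Finset Q, ∀ F : Finset Q,
      r ^ n * F.card ≤ ((Finset.image₂ (· * ·) F T').card : ℝ) := by
    intro n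
    induction n with
    | zero => exact ⟨{1}, fun F => by simp⟩
    | succ n ih =>
      obtain ⟨T', hT'⟩ := ih
      refine ⟨Finset.image₂ (· * ·) T' T, fun F => ?_⟩
      rw [← Finset.image₂_assoc (f := (· * ·)) (g := (· * ·)) (fun a b c => mul_assoc a b c)]
      calc r ^ (n + 1) * F.card = r * (r ^ n * F.card) := by ring
        _ ≤ r * ((Finset.image₂ (· * ·) F T').card : ℝ) := by gcongr; exact hT' F
        _ ≤ _ := hT _
  obtain ⟨n, hn⟩ := pow_unbounded_of_one_lt 2 hr
  obtain ⟨T', hT'⟩ := key n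
  refine ⟨T', fun F => ?_⟩
  have : (2 * F.card : ℝ) ≤ (Finset.image₂ (· * ·) F T').card :=
    (by gcongr : (2 * F.card : ℝ) ≤ r ^ n * F.card).trans (hT' F)
  exact_mod_cast this

/-- A non-amenable group can be mapped two-to-one into itself by an injection of two copies which
moves every element by a right translation from a fixed finite set. -/
theorem exists_doubling_injection {Q : Type*} [Group Q] (hQ : ¬ IsAmenableGroup Q) :
    ∃ (T : Finset Q) (ι : Q × Bool → Q), Function.Injective ι ∧
      ∀ x, ∃ t ∈ T, ι x = x.1 * t := by
  classical
  obtain ⟨T, hT⟩ := exists_finset_two_mul_card_le hQ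
  -- Hall's marriage theorem, each of the two copies of `x` being allowed the partners `x * t`. A
  -- set of copies has at most twice as many elements as its projection, so expansion by 2 is Hall's
  -- condition.
  have := (Finset.all_card_le_biUnion_card_iff_exists_injective
    (fun x : Q × Bool => T.image (x.1 * ·))).1 fun s => by
      have h1 : s ⊆ (s.image Prod.fst) ×ˢ (Finset.univ : Finset Bool) := fun x hx =>
        Finset.mem_product.2 ⟨Finset.mem_image_of_mem _ hx, Finset.mem_univ _⟩
      have h2 := Finset.card_le_card h1
      rw [Finset.card_product, Finset.card_univ, Fintype.card_bool] at h2
      have h3 := hT (s.image Prod.fst)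
      have h4 : Finset.image₂ (· * ·) (s.image Prod.fst) T
          ⊆ s.biUnion fun x => T.image (x.1 * ·) := by
        intro y hy
        obtain ⟨a, ha, b, hb, rfl⟩ := Finset.mem_image₂.1 hy
        obtain ⟨x, hx, rfl⟩ := Finset.mem_image.1 ha
        exact Finset.mem_biUnion.2 ⟨x, hx, Finset.mem_image_of_mem _ hb⟩
      have h5 : (Finset.image₂ (· * ·) (s.image Prod.fst) T).card
          ≤ (s.biUnion fun x => T.image (x.1 * ·)).card :=
        Finset.card_le_card (by convert h4)
      have h6 : 2 * (s.image Prod.fst).card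
          ≤ (Finset.image₂ (· * ·) (s.image Prod.fst) T).card := by convert h3
      omega
  obtain ⟨ι, hι, hmem⟩ := this
  refine ⟨T, ι, hι, fun x => ?_⟩
  obtain ⟨t, ht, h⟩ := Finset.mem_image.1 (hmem x)
  exact ⟨t, ht, h.symm⟩

/-! ### The induced space of a quotient of a subgroup -/

section Induced

variable {G : Type*} [Group G] {H : Subgroup G} {Q : Type*} [Group Q]

/-- The cocycle of the action of `G` on `G ⧸ H` for the transversal `Quotient.out`. -/
noncomputable def cosetCocycle (H : Subgroup G) (g : G) (i : G ⧸ H) : H :=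
  ⟨(g • i).out⁻¹ * g * i.out, by
    rw [mul_assoc, ← QuotientGroup.eq, QuotientGroup.out_eq']
    conv_lhs => rw [← QuotientGroup.out_eq' i]
    rfl⟩

theorem cosetCocycle_one (i : G ⧸ H) : cosetCocycle H 1 i = 1 := by
  ext
  simp [cosetCocycle]

theorem cosetCocycle_mul (g h : G) (i : G ⧸ H) :
    cosetCocycle H (g * h) i = cosetCocycle H g (h • i) * cosetCocycle H h i := by
  ext
  simp [cosetCocycle, mul_smul, mul_assoc]

/-- The `G`-space induced from the quotient `φ : H → Q` of the subgroup `H`. -/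
@[ext]
structure InducedSpace (φ : H →* Q) where
  fiber : Q
  base : G ⧸ H

/-- Multiplying by the inverse of the cocycle on the right turns the cocycle identity into the law
of a left action. Fibres are thus moved by right translations, as in the doubling injection of `Q`.
-/
noncomputable instance (φ : H →* Q) : MulAction G (InducedSpace φ) where
  smul g x := ⟨x.fiber * (φ (cosetCocycle H g x.base))⁻¹, g • x.base⟩
  one_smul x := by
    change InducedSpace.mk (x.fiber * (φ (cosetCocycle H 1 x.base))⁻¹) ((1 : G) • x.base) = x
    simp [cosetCocycle_one]
  mul_smul g h x := by
    change InducedSpace.mk (x.fiber * (φ (cosetCocycle H (g * h) x.base))⁻¹) ((g * h) • x.base)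
      = ⟨x.fiber * (φ (cosetCocycle H h x.base))⁻¹ * (φ (cosetCocycle H g (h • x.base)))⁻¹,
        g • h • x.base⟩
    simp [cosetCocycle_mul, mul_smul, mul_assoc]

theorem InducedSpace.smul_def (φ : H →* Q) (g : G) (x : InducedSpace φ) :
    g • x = ⟨x.fiber * (φ (cosetCocycle H g x.base))⁻¹, g • x.base⟩ := rfl

/-- The chosen element of `G` has cocycle exactly `h` at `i`. Hence all right translations of fibres
by values of `φ`, and all passages between fibres, come from `G`. -/
theorem InducedSpace.translate_smul (φ : H →* Q) (h : H) (i j : G ⧸ H) (q : Q) :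
    (j.out * (h : G) * i.out⁻¹) • (⟨q, i⟩ : InducedSpace φ) = ⟨q * (φ h)⁻¹, j⟩ := by
  have hj : (j.out * (h : G) * i.out⁻¹) • i = j := by
    conv_lhs => rw [← QuotientGroup.out_eq' i]
    conv_rhs => rw [← QuotientGroup.out_eq' j]
    rw [MulAction.Quotient.smul_mk, QuotientGroup.eq]
    simp
  have hc : cosetCocycle H (j.out * (h : G) * i.out⁻¹) i = h := by
    ext
    simp only [cosetCocycle, hj]
    group
  rw [InducedSpace.smul_def]
  simp only [hc, hj]

theorem InducedSpace.exists_smul (φ : H →* Q) (hφ : Function.Surjective φ)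
    (x y : InducedSpace φ) : ∃ g : G, g • x = y := by
  obtain ⟨q, i⟩ := x
  obtain ⟨p, j⟩ := y
  obtain ⟨h, hh⟩ := hφ (p⁻¹ * q)
  refine ⟨j.out * (h : G) * i.out⁻¹, (translate_smul φ h i j q).trans ?_⟩
  rw [hh]
  simp

theorem InducedSpace.exists_doubling_injection [H.FiniteIndex] (φ : H →* Q)
    (hφ : Function.Surjective φ) (hQ : ¬ IsAmenableGroup Q) :
    ∃ (T : Finset G) (ι : InducedSpace φ × Bool → InducedSpace φ), Function.Injective ι ∧
      ∀ x, ∃ t ∈ T, ι x = t • x.1 := by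
  classical
  obtain ⟨T, ι, hι, hT⟩ := _root_.exists_doubling_injection hQ
  have := H.fintypeQuotientOfFiniteIndex
  choose s hs using hφ
  -- Doubling is done fibrewise. Right translation by `t` over `i` is realised by an element
  -- depending on both, and finitely many cosets keep the set finite; `t⁻¹` is lifted because the
  -- action inverts.
  refine ⟨Finset.image₂ (fun (t : Q) (i : G ⧸ H) => i.out * (s t⁻¹ : G) * i.out⁻¹) T Finset.univ,
    fun x => ⟨ι (x.1.fiber, x.2), x.1.base⟩, ?_, ?_⟩
  · rintro ⟨⟨q, i⟩, b⟩ ⟨⟨q', i'⟩, b'⟩ h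
    obtain ⟨h1, h2⟩ := InducedSpace.mk.inj h
    have h3 := Prod.mk.inj (hι h1)
    simp only at h2 h3
    rw [h2, h3.1, h3.2]
  · rintro ⟨⟨q, i⟩, b⟩
    obtain ⟨t, ht, h⟩ := hT (q, b)
    refine ⟨_, Finset.mem_image₂_of_mem ht (Finset.mem_univ i), ?_⟩
    rw [translate_smul φ (s t⁻¹) i i q, hs, inv_inv]
    simp only [h]

end Induced

/-! ### Translations on `ℓ²` of a `G`-space and the spectral gap -/

section Koopman

variable {G X : Type*} [Group G] [MulAction G X]

theorem lp_two_norm_sq {X : Type*} (f : lp (fun _ : X => ℝ) 2) : ‖f‖ ^ 2 = ∑' x, f x ^ 2 := by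
  have h := lp.norm_rpow_eq_tsum (p := 2) (by norm_num) f
  simpa using h

theorem lp_two_summable_sq {X : Type*} (f : lp (fun _ : X => ℝ) 2) :
    Summable fun x => f x ^ 2 := by
  have h := (lp.memℓp f).summable (p := 2) (by norm_num)
  simpa using h

/-- Translation of square-summable functions on a `G`-space. -/
noncomputable def koopman (X : Type*) [MulAction G X] (g : G) :
    lp (fun _ : X => ℝ) 2 →ₗᵢ[ℝ] lp (fun _ : X => ℝ) 2 where
  toFun f := ⟨fun x => f (g • x), memℓp_gen (by
    have h := (lp.memℓp f).summable (p := 2) (by norm_num)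
    exact h.comp_injective (MulAction.injective g))⟩
  map_add' _ _ := rfl
  map_smul' _ _ := rfl
  norm_map' f := by
    rw [← sq_eq_sq₀ (norm_nonneg _) (norm_nonneg _), lp_two_norm_sq, lp_two_norm_sq]
    exact (MulAction.toPerm g).tsum_eq fun x => f x ^ 2

theorem koopman_apply (g : G) (f : lp (fun _ : X => ℝ) 2) (x : X) :
    koopman X g f x = f (g • x) := rfl

theorem koopman_mul (g h : G) (f : lp (fun _ : X => ℝ) 2) :
    koopman X (g * h) f = koopman X h (koopman X g f) := by
  ext x
  simp [koopman_apply, mul_smul]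

theorem koopman_inv_koopman (g : G) (f : lp (fun _ : X => ℝ) 2) :
    koopman X g⁻¹ (koopman X g f) = f := by
  ext x
  simp [koopman_apply]

theorem inner_koopman_left (g : G) (f f' : lp (fun _ : X => ℝ) 2) :
    inner ℝ (koopman X g f) f' = inner ℝ f (koopman X g⁻¹ f') := by
  rw [← (koopman X g⁻¹).inner_map_map, koopman_inv_koopman]

/-- Translations are isometries, so the displacement of `f` is subadditive under products and
unchanged under inversion. -/
theorem exists_norm_koopman_sub_le {A : Type*} [Fintype A] {γ : A → G}
    (hγ : IsGeneratingFamily γ) (g : G) :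
    ∃ C : ℝ, 0 ≤ C ∧ ∀ f : lp (fun _ : X => ℝ) 2,
      ‖koopman X g f - f‖ ≤ C * ∑ a, ‖koopman X (γ a) f - f‖ := by
  have hg : g ∈ Subgroup.closure (Set.range γ) := by rw [hγ]; trivial
  induction hg using Subgroup.closure_induction with
  | mem x hx =>
    obtain ⟨a, rfl⟩ := hx
    refine ⟨1, zero_le_one, fun f => ?_⟩
    rw [one_mul]
    exact Finset.single_le_sum (f := fun a => ‖koopman X (γ a) f - f‖)
      (fun _ _ => norm_nonneg _) (Finset.mem_univ a)
  | one =>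
    refine ⟨0, le_rfl, fun f => ?_⟩
    have : koopman X (1 : G) f = f := by ext x; simp [koopman_apply]
    simp [this]
  | mul x y _ _ hx hy =>
    obtain ⟨C, hC, h⟩ := hx
    obtain ⟨C', hC', h'⟩ := hy
    refine ⟨C + C', add_nonneg hC hC', fun f => ?_⟩
    have h1 : koopman X (x * y) f - f
        = koopman X y (koopman X x f - f) + (koopman X y f - f) := by
      rw [koopman_mul, map_sub]; abel
    calc ‖koopman X (x * y) f - f‖ ≤ ‖koopman X x f - f‖ + ‖koopman X y f - f‖ := by
          rw [h1]
          refine (norm_add_le _ _).trans_eq ?_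
          rw [LinearIsometry.norm_map]
      _ ≤ _ := by rw [add_mul]; exact add_le_add (h f) (h' f)
  | inv x _ hx =>
    obtain ⟨C, hC, h⟩ := hx
    refine ⟨C, hC, fun f => ?_⟩
    have h1 : koopman X x⁻¹ f - f = -(koopman X x⁻¹ (koopman X x f - f)) := by
      rw [map_sub, koopman_inv_koopman]; abel
    rw [h1, norm_neg, LinearIsometry.norm_map]
    exact h f

/-- Functions on a space with a bounded doubling injection are far from invariant. -/
theorem exists_norm_sq_le_sum_of_doubling {T : Finset G} {ι : X × Bool → X}
    (hι : Function.Injective ι) (hT : ∀ x, ∃ t ∈ T, ι x = t • x.1)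
    (f : lp (fun _ : X => ℝ) 2) :
    ‖f‖ ^ 2 ≤ 12 * ∑ t ∈ T, ‖koopman X t f - f‖ ^ 2 := by
  have hs := lp_two_summable_sq f
  have hD : ∀ t : G, Summable fun x : X => (f (t • x) - f x) ^ 2 := fun t =>
    lp_two_summable_sq (koopman X t f - f)
  have hDs : Summable fun x : X => ∑ t ∈ T, (f (t • x) - f x) ^ 2 :=
    summable_sum fun t _ => hD t
  have hι1 : Summable fun x : X × Bool => f (ι x) ^ 2 := hs.comp_injective hι
  have hib : ∀ b, Summable fun x => f (ι (x, b)) ^ 2 := fun b =>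
    hs.comp_injective (i := fun x : X => ι (x, b)) fun x y h => (Prod.mk.inj (hι h)).1
  have hpt : ∀ (b : Bool) (x : X), f x ^ 2 ≤ 3 / 2 * f (ι (x, b)) ^ 2
      + 3 * ∑ t ∈ T, (f (t • x) - f x) ^ 2 := by
    intro b x
    obtain ⟨t, ht, h⟩ := hT (x, b)
    have h1 : (f (t • x) - f x) ^ 2 ≤ ∑ t ∈ T, (f (t • x) - f x) ^ 2 :=
      Finset.single_le_sum (f := fun t => (f (t • x) - f x) ^ 2) (fun _ _ => sq_nonneg _) ht
    rw [h]
    simp only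
    -- With `a = f x` and `b = f (t • x)`, the difference of the two sides is at least `(3 * b - 2 *
    -- a) ^ 2 / 2`. The coefficient `3 / 2` must be less than 2, the number of copies: adding both
    -- copies gives `2 * ‖f‖ ^ 2 ≤ 3 / 2 * ‖f‖ ^ 2 + 6 * ∑`, hence 12.
    nlinarith [sq_nonneg (3 * f (t • x) - 2 * f x)]
  have hb : ∀ b, ‖f‖ ^ 2 ≤ 3 / 2 * ∑' x, f (ι (x, b)) ^ 2
      + 3 * ∑ t ∈ T, ‖koopman X t f - f‖ ^ 2 := by
    intro b
    have h1 : ∑ t ∈ T, ‖koopman X t f - f‖ ^ 2 = ∑' x, ∑ t ∈ T, (f (t • x) - f x) ^ 2 := by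
      rw [Summable.tsum_finsetSum fun t _ => hD t]
      exact Finset.sum_congr rfl fun t _ => lp_two_norm_sq _
    rw [h1, lp_two_norm_sq, ← tsum_mul_left, ← tsum_mul_left,
      ← ((hib b).mul_left _).tsum_add (hDs.mul_left _)]
    exact hs.tsum_le_tsum (hpt b) (((hib b).mul_left _).add (hDs.mul_left _))
  have hsum : ∑' x, f (ι (x, true)) ^ 2 + ∑' x, f (ι (x, false)) ^ 2 ≤ ‖f‖ ^ 2 := by
    have h1 : ∑' x : X × Bool, f (ι x) ^ 2 ≤ ∑' x, f x ^ 2 :=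
      hι1.tsum_le_tsum_of_inj ι hι (fun _ _ => sq_nonneg _) (fun _ => le_rfl) hs
    have h2 : ∑' x : X × Bool, f (ι x) ^ 2 = ∑' x, ∑' b, f (ι (x, b)) ^ 2 := hι1.tsum_prod
    rw [lp_two_norm_sq]
    refine le_trans (le_of_eq ?_) (h2 ▸ h1)
    rw [← (hib true).tsum_add (hib false)]
    refine tsum_congr fun x => ?_
    rw [tsum_bool, add_comm]
  linarith [hb true, hb false]

/-- The spectral gap of a space with a bounded doubling injection. -/
theorem exists_norm_sq_le_energy {A : Type*} [Fintype A] {γ : A → G}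
    (hγ : IsGeneratingFamily γ) {T : Finset G} {ι : X × Bool → X}
    (hι : Function.Injective ι) (hT : ∀ x, ∃ t ∈ T, ι x = t • x.1) :
    ∃ K : ℝ, 0 < K ∧ ∀ f : lp (fun _ : X => ℝ) 2,
      ‖f‖ ^ 2 ≤ K * ∑ a, ‖koopman X (γ a) f - f‖ ^ 2 := by
  choose C hC h using exists_norm_koopman_sub_le (X := X) hγ
  refine ⟨12 * (∑ t ∈ T, C t ^ 2) * Fintype.card A + 1, ?_, fun f => ?_⟩
  · have : 0 ≤ ∑ t ∈ T, C t ^ 2 := Finset.sum_nonneg fun _ _ => sq_nonneg _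
    positivity
  have hE : (∑ a, ‖koopman X (γ a) f - f‖) ^ 2
      ≤ Fintype.card A * ∑ a, ‖koopman X (γ a) f - f‖ ^ 2 := by
    simpa using sq_sum_le_card_mul_sum_sq (s := (Finset.univ : Finset A))
      (f := fun a => ‖koopman X (γ a) f - f‖)
  have hE0 : 0 ≤ ∑ a, ‖koopman X (γ a) f - f‖ ^ 2 := Finset.sum_nonneg fun _ _ => sq_nonneg _
  calc ‖f‖ ^ 2 ≤ 12 * ∑ t ∈ T, ‖koopman X t f - f‖ ^ 2 :=
        exists_norm_sq_le_sum_of_doubling hι hT f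
    _ ≤ 12 * ∑ t ∈ T, C t ^ 2 * (Fintype.card A * ∑ a, ‖koopman X (γ a) f - f‖ ^ 2) := by
        gcongr with t ht
        refine (pow_le_pow_left₀ (norm_nonneg _) (h t f) 2).trans ?_
        rw [mul_pow]
        gcongr
    _ = 12 * (∑ t ∈ T, C t ^ 2) * Fintype.card A * ∑ a, ‖koopman X (γ a) f - f‖ ^ 2 := by
        rw [← Finset.sum_mul]; ring
    _ ≤ _ := by linarith

/-- A positive symmetric operator is bounded by its quadratic form. -/
theorem norm_le_of_inner_le {E : Type*} [NormedAddCommGroup E] [InnerProductSpace ℝ E]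
    (T : E →ₗ[ℝ] E) (hsymm : T.IsSymmetric) (hpos : ∀ x, 0 ≤ inner ℝ (T x) x) {c : ℝ}
    (hc : 0 < c) (hle : ∀ x, inner ℝ (T x) x ≤ c * ‖x‖ ^ 2) (x : E) : ‖T x‖ ≤ c * ‖x‖ := by
  -- Expanding the form at `c • x - T x` and bounding it at `T x` yields `c * ‖T x‖ ^ 2 ≤ c ^ 2 * ⟪T
  -- x, x⟫`.
  have h1 := hpos (c • x - T x)
  have h2 := hle (T x)
  have h3 := hle x
  have h4 : inner ℝ (T (T x)) x = ‖T x‖ ^ 2 := by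
    rw [hsymm, real_inner_self_eq_norm_sq]
  simp only [map_sub, map_smul, inner_sub_left, inner_sub_right, inner_smul_left,
    inner_smul_right, real_inner_self_eq_norm_sq, h4, RCLike.conj_to_real] at h1
  have h5 : c * ‖T x‖ ^ 2 ≤ c * (c * ‖x‖) ^ 2 := by
    have := mul_le_mul_of_nonneg_left h3 (sq_nonneg c)
    nlinarith
  exact (pow_le_pow_iff_left₀ (norm_nonneg _) (by positivity) two_ne_zero).1
    (le_of_mul_le_mul_left h5 hc)

/-- The lazy adjacency operator of a `G`-space, with loops. -/
noncomputable def lazyAdjacency (X : Type*) [MulAction G X] {A : Type*} [Fintype A] (γ : A → G) :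
    lp (fun _ : X => ℝ) 2 →ₗ[ℝ] lp (fun _ : X => ℝ) 2 :=
  ∑ a, ((koopman X (γ a)).toLinearMap + (koopman X (γ a)⁻¹).toLinearMap + (2 : ℝ) • LinearMap.id)

section LazyAdjacency

variable {A : Type*} [Fintype A] (γ : A → G)

theorem lazyAdjacency_apply (f : lp (fun _ : X => ℝ) 2) :
    lazyAdjacency X γ f = ∑ a, (koopman X (γ a) f + koopman X (γ a)⁻¹ f + (2 : ℝ) • f) := by
  simp [lazyAdjacency]

theorem lazyAdjacency_apply_apply (f : lp (fun _ : X => ℝ) 2) (x : X) :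
    lazyAdjacency X γ f x = ∑ a, (f (γ a • x) + f ((γ a)⁻¹ • x) + 2 * f x) := by
  rw [lazyAdjacency_apply, lp.coeFn_sum, Finset.sum_apply]
  rfl

theorem isSymmetric_lazyAdjacency : (lazyAdjacency X γ).IsSymmetric := by
  intro f f'
  simp only [lazyAdjacency_apply, sum_inner, inner_sum, inner_add_left, inner_add_right,
    inner_smul_left, inner_smul_right, inner_koopman_left, inv_inv, RCLike.conj_to_real]
  exact Finset.sum_congr rfl fun a _ => by ring

theorem inner_lazyAdjacency (f : lp (fun _ : X => ℝ) 2) :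
    inner ℝ (lazyAdjacency X γ f) f
      = ∑ a, (2 * inner ℝ (koopman X (γ a) f) f + 2 * ‖f‖ ^ 2) := by
  simp only [lazyAdjacency_apply, sum_inner, inner_add_left, inner_smul_left,
    RCLike.conj_to_real, real_inner_self_eq_norm_sq]
  refine Finset.sum_congr rfl fun a _ => ?_
  rw [inner_koopman_left (γ a)⁻¹, inv_inv, real_inner_comm f]
  ring

/-- Each summand of the form is `‖koopman X (γ a) f + f‖ ^ 2`. The loops are there for this
positivity, which lets the quadratic form control the norm. -/
theorem inner_lazyAdjacency_nonneg (f : lp (fun _ : X => ℝ) 2) :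
    0 ≤ inner ℝ (lazyAdjacency X γ f) f := by
  rw [inner_lazyAdjacency]
  refine Finset.sum_nonneg fun a _ => ?_
  have := norm_add_sq_real (koopman X (γ a) f) f
  rw [LinearIsometry.norm_map] at this
  nlinarith [sq_nonneg ‖koopman X (γ a) f + f‖]

theorem inner_lazyAdjacency_eq (f : lp (fun _ : X => ℝ) 2) :
    inner ℝ (lazyAdjacency X γ f) f
      = 4 * Fintype.card A * ‖f‖ ^ 2 - ∑ a, ‖koopman X (γ a) f - f‖ ^ 2 := by
  rw [inner_lazyAdjacency]
  have (a : A) : 2 * inner ℝ (koopman X (γ a) f) f + 2 * ‖f‖ ^ 2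
      = 4 * ‖f‖ ^ 2 - ‖koopman X (γ a) f - f‖ ^ 2 := by
    have := norm_sub_sq_real (koopman X (γ a) f) f
    rw [LinearIsometry.norm_map] at this
    linarith
  simp only [this, Finset.sum_sub_distrib, Finset.sum_const, Finset.card_univ, nsmul_eq_mul]
  ring

theorem lazyAdjacency_nonneg {f : lp (fun _ : X => ℝ) 2} (hf : ∀ x, 0 ≤ f x) (x : X) :
    0 ≤ lazyAdjacency X γ f x := by
  rw [lazyAdjacency_apply_apply]
  refine Finset.sum_nonneg fun a _ => ?_
  have := hf x
  have := hf (γ a • x)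
  have := hf ((γ a)⁻¹ • x)
  positivity

theorem iterate_lazyAdjacency_nonneg {f : lp (fun _ : X => ℝ) 2} (hf : ∀ x, 0 ≤ f x) (n : ℕ) :
    ∀ x, 0 ≤ (lazyAdjacency X γ)^[n] f x := by
  induction n with
  | zero => exact hf
  | succ n ih =>
    rw [Function.iterate_succ_apply']
    exact lazyAdjacency_nonneg γ ih

theorem norm_iterate_lazyAdjacency_le {c : ℝ} (hc : 0 ≤ c)
    (h : ∀ f, ‖lazyAdjacency X γ f‖ ≤ c * ‖f‖) (f : lp (fun _ : X => ℝ) 2) (n : ℕ) :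
    ‖(lazyAdjacency X γ)^[n] f‖ ≤ c ^ n * ‖f‖ := by
  induction n with
  | zero => simp
  | succ n ih =>
    rw [Function.iterate_succ_apply', pow_succ']
    calc _ ≤ c * ‖(lazyAdjacency X γ)^[n] f‖ := h _
      _ ≤ c * (c ^ n * ‖f‖) := by gcongr
      _ = _ := by ring

/-- A norm gap of the lazy adjacency operator yields a positive function, the Green function,
which is superharmonic up to a factor less than the number of neighbours. -/
theorem exists_superharmonic_of_norm_le [MulAction.IsPretransitive G X] [Nonempty X]
    (hγ : IsGeneratingFamily γ) {c : ℝ} (hc0 : 0 < c) (hc : c < 4 * Fintype.card A)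
    (hle : ∀ f, ‖lazyAdjacency X γ f‖ ≤ c * ‖f‖) :
    ∃ (u : X → ℝ) (l : ℝ), l < 2 * Fintype.card A ∧ (∀ x, 0 < u x) ∧
      ∀ x, ∑ a, (u (γ a • x) + u ((γ a)⁻¹ • x)) ≤ l * u x := by
  classical
  obtain ⟨x₀⟩ := ‹Nonempty X›
  -- Since `b > c`, the series of `T ^ n δ / b ^ n` for the operator `T` converges geometrically;
  -- since `b < 4 * card A`, its sum `u` still has a gap.
  obtain ⟨b, hcb, hb⟩ := exists_between hc
  have hb0 : 0 < b := hc0.trans hcb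
  set δ : lp (fun _ : X => ℝ) 2 := lp.single 2 x₀ 1 with hδ
  have hδ0 : ∀ x, 0 ≤ δ x := by
    intro x
    rw [hδ, lp.single_apply, Pi.single_apply]
    split_ifs <;> norm_num
  set F : ℕ → X → ℝ := fun n x => (lazyAdjacency X γ)^[n] δ x with hF
  have hF0 : ∀ n x, 0 ≤ F n x := iterate_lazyAdjacency_nonneg γ hδ0
  have hFle : ∀ n x, F n x / b ^ n ≤ (c / b) ^ n * ‖δ‖ := by
    intro n x
    have h1 := (lp.norm_apply_le_norm two_ne_zero ((lazyAdjacency X γ)^[n] δ) x).trans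
      (norm_iterate_lazyAdjacency_le γ hc0.le hle δ n)
    rw [Real.norm_of_nonneg (hF0 n x)] at h1
    rw [div_pow, div_mul_eq_mul_div]
    gcongr
  have hsum : ∀ x, Summable fun n => F n x / b ^ n := fun x =>
    Summable.of_nonneg_of_le (fun n => div_nonneg (hF0 n x) (pow_nonneg hb0.le n))
      (fun n => hFle n x)
      ((summable_geometric_of_lt_one (by positivity) ((div_lt_one hb0).2 hcb)).mul_right _)
  set u : X → ℝ := fun x => ∑' n, F n x / b ^ n with hu
  have hu0 : ∀ x, 0 ≤ u x := fun x =>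
    tsum_nonneg fun n => div_nonneg (hF0 n x) (pow_nonneg hb0.le n)
  have hux₀ : 0 < u x₀ := by
    refine (hsum x₀).tsum_pos (fun n => div_nonneg (hF0 n x₀) (pow_nonneg hb0.le n)) 0 ?_
    simp [hF, hδ]
  -- Shifting the series gives `T u = b * (u - δ) ≤ b * u`.
  have hle' : ∀ x, ∑ a, (u (γ a • x) + u ((γ a)⁻¹ • x) + 2 * u x) ≤ b * u x := by
    intro x
    have h1 : ∑ a, (u (γ a • x) + u ((γ a)⁻¹ • x) + 2 * u x) = ∑' n, F (n + 1) x / b ^ n := by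
      have h2 : ∀ n, F (n + 1) x / b ^ n = ∑ a, (F n (γ a • x) / b ^ n
          + F n ((γ a)⁻¹ • x) / b ^ n + 2 * (F n x / b ^ n)) := by
        intro n
        simp only [hF, Function.iterate_succ_apply', lazyAdjacency_apply_apply, Finset.sum_div]
        exact Finset.sum_congr rfl fun a _ => by ring
      have h3 : ∀ a, Summable fun n => F n (γ a • x) / b ^ n
          + F n ((γ a)⁻¹ • x) / b ^ n + 2 * (F n x / b ^ n) := fun a =>
        ((hsum _).add (hsum _)).add ((hsum x).mul_left 2)
      simp only [h2]
      rw [Summable.tsum_finsetSum fun a _ => h3 a]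
      refine Finset.sum_congr rfl fun a _ => ?_
      rw [((hsum _).add (hsum _)).tsum_add ((hsum x).mul_left 2), (hsum _).tsum_add (hsum _),
        tsum_mul_left]
    have h4 : u x = F 0 x + ∑' n, F (n + 1) x / b ^ (n + 1) := by
      have := (hsum x).tsum_eq_zero_add
      simpa using this
    have h5 : b * ∑' n, F (n + 1) x / b ^ (n + 1) = ∑' n, F (n + 1) x / b ^ n := by
      rw [← tsum_mul_left]
      refine tsum_congr fun n => ?_
      rw [pow_succ]
      field_simp
    rw [h1, h4, mul_add, h5]
    have := mul_nonneg hb0.le (hF0 0 x)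
    linarith
  -- A neighbour's value is at most `b` times the value at the point, so positivity spreads from
  -- `x₀` along generators to the whole transitive space.
  have hstep : ∀ x y, 0 < u x → (∃ a, x = γ a • y ∨ x = (γ a)⁻¹ • y) → 0 < u y := by
    rintro x y hx ⟨a, ha⟩
    have h1 : u (γ a • y) + u ((γ a)⁻¹ • y) + 2 * u y ≤ b * u y :=
      (Finset.single_le_sum (f := fun a => u (γ a • y) + u ((γ a)⁻¹ • y) + 2 * u y)
        (fun a _ => by have := hu0 (γ a • y); have := hu0 ((γ a)⁻¹ • y); have := hu0 y; positivity)
        (Finset.mem_univ a)).trans (hle' y)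
    have h2 : u x ≤ b * u y := by
      rcases ha with rfl | rfl
      · linarith [hu0 ((γ a)⁻¹ • y), hu0 y]
      · linarith [hu0 (γ a • y), hu0 y]
    exact pos_of_mul_pos_right (hx.trans_le h2) hb0.le
  have hpos : ∀ g : G, (∀ x, 0 < u x → 0 < u (g • x)) := by
    intro g
    have hg : g ∈ Subgroup.closure (Set.range γ) := by rw [hγ]; trivial
    induction hg using Subgroup.closure_induction'' with
    | mem x hx =>
      obtain ⟨a, rfl⟩ := hx
      exact fun x hx => hstep x _ hx ⟨a, Or.inr (by simp)⟩
    | inv_mem x hx =>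
      obtain ⟨a, rfl⟩ := hx
      exact fun x hx => hstep x _ hx ⟨a, Or.inl (by simp)⟩
    | one => simp
    | mul x y _ _ hx hy => exact fun z hz => by rw [mul_smul]; exact hx _ (hy _ hz)
  -- Removing the loops subtracts `2 * card A` from the factor.
  refine ⟨u, b - 2 * Fintype.card A, by linarith, fun x => ?_, fun x => ?_⟩
  · obtain ⟨g, rfl⟩ := MulAction.exists_smul_eq G x₀ x
    exact hpos g x₀ hux₀
  · have := hle' x
    rw [Finset.sum_add_distrib] at this
    simp only [Finset.sum_const, Finset.card_univ, nsmul_eq_mul] at this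
    linarith

/-- The energy bound pushes the quadratic form below `4 * card A`, and positivity turns this into
the norm gap that the Green function needs. -/
theorem exists_superharmonic_of_doubling [MulAction.IsPretransitive G X] [Nonempty X]
    (hγ : IsGeneratingFamily γ) {T : Finset G} {ι : X × Bool → X}
    (hι : Function.Injective ι) (hT : ∀ x, ∃ t ∈ T, ι x = t • x.1) :
    Nonempty A ∧ ∃ (u : X → ℝ) (l : ℝ), l < 2 * Fintype.card A ∧ (∀ x, 0 < u x) ∧
      ∀ x, ∑ a, (u (γ a • x) + u ((γ a)⁻¹ • x)) ≤ l * u x := by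
  classical
  obtain ⟨K, hK, hle⟩ := exists_norm_sq_le_energy hγ hι hT
  have hA : Nonempty A := by
    -- Without letters the energy vanishes, but a point mass has norm 1.
    by_contra hA
    rw [not_nonempty_iff] at hA
    obtain ⟨x₀⟩ := ‹Nonempty X›
    have := hle (lp.single 2 x₀ 1)
    norm_num [lp.norm_single] at this
  refine ⟨hA, ?_⟩
  have hcard : (1 : ℝ) ≤ Fintype.card A := by exact_mod_cast Fintype.card_pos
  -- With `K + 1` in place of `K` the gap is at most 1, which keeps the norm bound positive.
  have hK1 : (K + 1)⁻¹ ≤ 1 := inv_le_one_of_one_le₀ (by linarith)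
  have hc0 : 0 < 4 * (Fintype.card A : ℝ) - (K + 1)⁻¹ := by linarith
  refine exists_superharmonic_of_norm_le γ hγ (c := 4 * Fintype.card A - (K + 1)⁻¹) hc0
    (by have : 0 < (K + 1)⁻¹ := by positivity
        linarith) fun f =>
    norm_le_of_inner_le _ (isSymmetric_lazyAdjacency γ) (inner_lazyAdjacency_nonneg γ) hc0
      (fun f => ?_) f
  rw [inner_lazyAdjacency_eq, sub_mul]
  have hE0 : 0 ≤ ∑ a, ‖koopman X (γ a) f - f‖ ^ 2 := Finset.sum_nonneg fun _ _ => sq_nonneg _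
  have : (K + 1)⁻¹ * ‖f‖ ^ 2 ≤ ∑ a, ‖koopman X (γ a) f - f‖ ^ 2 := by
    rw [inv_mul_le_iff₀ (by linarith)]
    linarith [hle f]
  linarith

end LazyAdjacency

end Koopman

/-! ### Counting reduced words that return to the base point -/

section NonBacktracking

variable {A X : Type*} [Fintype A] (act : A × Bool → X → X)

/-- Along a positive function that is superharmonic up to a factor less than the number `q + 1` of
neighbours, the ratio of neighbouring values is bounded below by some `c` in `(1 / q, 1)`. -/
theorem exists_ratio_bound (hact : ∀ s x, act (s.1, !s.2) (act s x) = x) [Nonempty A] [Nonempty X]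
    {u : X → ℝ} (hu : ∀ x, 0 < u x) {l q : ℝ} (hq : q + 1 = Fintype.card (A × Bool))
    (hl : l < q + 1) (hle : ∀ x, ∑ s, u (act s x) ≤ l * u x) :
    ∃ c : ℝ, 1 < q * c ∧ c < 1 ∧ ∀ s x, c * u x ≤ u (act s x) := by
  classical
  have hq1 : 1 ≤ q := by
    rw [Fintype.card_prod, Fintype.card_bool] at hq
    have : (1 : ℝ) ≤ Fintype.card A := by exact_mod_cast Fintype.card_pos
    push_cast at hq
    linarith
  obtain ⟨x₀⟩ := ‹Nonempty X›
  obtain ⟨a₀⟩ := ‹Nonempty A›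
  have hsplit : ∀ s x, u x + ∑ s' ∈ Finset.univ.erase (s.1, !s.2), u (act s' (act s x))
      ≤ l * u (act s x) := by
    intro s x
    have := hle (act s x)
    rwa [← Finset.add_sum_erase _ _ (Finset.mem_univ (s.1, !s.2)), hact] at this
  have hlpos : ∀ s x, u x ≤ l * u (act s x) := fun s x =>
    (le_add_of_nonneg_right (Finset.sum_nonneg fun _ _ => (hu _).le)).trans (hsplit s x)
  have hl0 : 0 < l :=
    pos_of_mul_pos_left ((hu x₀).trans_le (hlpos (a₀, true) x₀)) (hu _).le
  -- The required `c` is the infimum of all ratios of neighbouring values.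
  set R : Set ℝ := Set.range fun p : (A × Bool) × X => u (act p.1 p.2) / u p.2 with hR
  have hRne : R.Nonempty := ⟨_, ⟨((a₀, true), x₀), rfl⟩⟩
  have hlb : ∀ r : ℝ, (∀ s x, r * u x ≤ u (act s x)) → r ≤ sInf R := by
    intro r hr
    refine le_csInf hRne ?_
    rintro _ ⟨⟨s, x⟩, rfl⟩
    exact (le_div_iff₀ (hu x)).2 (hr s x)
  have hR0 : ∀ r ∈ R, 0 ≤ r := by
    rintro _ ⟨p, rfl⟩
    exact div_nonneg (hu _).le (hu _).le
  have hc : ∀ s x, sInf R * u x ≤ u (act s x) := by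
    intro s x
    rw [← le_div_iff₀ (hu x)]
    exact csInf_le ⟨0, hR0⟩ ⟨(s, x), rfl⟩
  generalize sInf R = c at hlb hc
  have hc0 : 0 < c := (inv_pos.2 hl0).trans_le <| hlb _ fun s x => by
    rw [inv_mul_le_iff₀ hl0]
    exact hlpos s x
  -- Bootstrapping: besides `x`, the point `act s x` has `q` neighbours, each with value at least `c
  -- * u (act s x)`. So every ratio is at least `(l - q * c)⁻¹`, and hence so is `c`.
  have himp : ∀ s x, u x ≤ (l - q * c) * u (act s x) := by
    intro s x
    have h1 : q * (c * u (act s x))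
        ≤ ∑ s' ∈ Finset.univ.erase (s.1, !s.2), u (act s' (act s x)) := by
      have h2 := Finset.card_nsmul_le_sum (Finset.univ.erase (s.1, !s.2))
        (fun s' => u (act s' (act s x))) (c * u (act s x)) (fun s' _ => hc _ _)
      rw [nsmul_eq_mul, Finset.card_erase_of_mem (Finset.mem_univ _), Finset.card_univ,
        Nat.cast_sub Fintype.card_pos, ← hq] at h2
      simpa using h2
    have := hsplit s x
    linarith
  have hd : 0 < l - q * c :=
    pos_of_mul_pos_left ((hu x₀).trans_le (himp (a₀, true) x₀)) (hu _).le
  have h1 : (l - q * c)⁻¹ ≤ c := hlb _ fun s x => by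
    rw [inv_mul_le_iff₀ hd]
    exact himp s x
  have h2 : 1 ≤ (l - q * c) * c := by
    have := mul_le_mul_of_nonneg_left h1 hd.le
    rwa [mul_inv_cancel₀ hd.ne'] at this
  -- From `1 ≤ (l - q * c) * c` and `l < q + 1`; so `c` lies strictly between the roots `1 / q` and
  -- 1.
  have h3 : (q * c - 1) * (c - 1) < 0 := by nlinarith
  refine ⟨c, ?_, ?_, hc⟩
  · by_contra h
    push Not at h
    have : c ≤ 1 := by nlinarith
    nlinarith
  · by_contra h
    push Not at h
    have : 1 ≤ q * c := by nlinarith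
    nlinarith

/-- A positive supersolution for walks without backtracking, with a factor `r < q`. -/
theorem exists_nonbacktracking_supersolution (hact : ∀ s x, act (s.1, !s.2) (act s x) = x)
    [DecidableEq A] [Nonempty A] [Nonempty X]
    {u : X → ℝ} (hu : ∀ x, 0 < u x) {l q : ℝ} (hq : q + 1 = Fintype.card (A × Bool))
    (hl : l < q + 1) (hle : ∀ x, ∑ s, u (act s x) ≤ l * u x) :
    ∃ (f : A × Bool → X → ℝ) (r ε : ℝ), 0 < r ∧ r < q ∧ 0 < ε ∧
      (∀ s x, ε * u (act s x) ≤ f s x) ∧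
      ∀ s x, ∑ s' ∈ Finset.univ.erase (s.1, !s.2), f s' (act s x) ≤ r * f s x := by
  obtain ⟨c, hc1, hc2, hc⟩ := exists_ratio_bound act hact hu hq hl hle
  have hq1 : 1 < q := by
    rw [Fintype.card_prod, Fintype.card_bool] at hq
    have : (1 : ℝ) ≤ Fintype.card A := by exact_mod_cast Fintype.card_pos
    push_cast at hq
    nlinarith
  have hq0 : 0 < q := by linarith
  have hc0 : 0 < c := by nlinarith
  have hqc : q⁻¹ < c := (inv_lt_iff_one_lt_mul₀' hq0).2 hc1
  -- For `f s x = u (act s x) - t * u x`, positivity needs `t < c`, and the supersolution inequality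
  -- with `r = t⁻¹` reduces to `l * t ≤ q * t ^ 2 + 1`. The latter is strict at `t = 1 / q` because
  -- `l < q + 1`, so it survives slightly above, where `t⁻¹ < q`.
  obtain ⟨t, ht1, ht⟩ := exists_between (lt_min hqc
    (show q⁻¹ < q⁻¹ + (q + 1 - l) / q ^ 2 by
      have : 0 < (q + 1 - l) / q ^ 2 := div_pos (by linarith) (by positivity)
      linarith))
  obtain ⟨htc, ht2⟩ := lt_min_iff.1 ht
  have ht0 : 0 < t := (inv_pos.2 hq0).trans ht1
  have hqt : 1 < q * t := (inv_lt_iff_one_lt_mul₀' hq0).1 ht1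
  have hlt : l * t ≤ q * t ^ 2 + 1 := by
    have h1 : q ^ 2 * t ≤ q + (q + 1 - l) := by
      have := mul_le_mul_of_nonneg_left ht2.le (sq_nonneg q)
      rw [mul_add, mul_div_cancel₀ _ (by positivity)] at this
      calc q ^ 2 * t ≤ q ^ 2 * q⁻¹ + (q + 1 - l) := this
        _ = _ := by field_simp
    have h2 : 0 ≤ q * (q * t ^ 2 + 1 - l * t) := by
      have h3 : q * (q * t ^ 2 + 1 - l * t) = (q * t - 1) * (q * t)
          + (q + 1 - l) * (q * t - 1) + (q + 1 - l - (q ^ 2 * t - q)) := by ring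
      rw [h3]
      have := mul_nonneg (sub_nonneg.2 hqt.le) (by positivity : 0 ≤ q * t)
      have := mul_nonneg (sub_nonneg.2 hl.le) (sub_nonneg.2 hqt.le)
      linarith
    linarith [nonneg_of_mul_nonneg_right h2 hq0]
  refine ⟨fun s x => u (act s x) - t * u x, t⁻¹, 1 - t / c, inv_pos.2 ht0,
    inv_lt_of_inv_lt₀ hq0 ht1, by rw [sub_pos, div_lt_one hc0]; exact htc, ?_, ?_⟩
  · intro s x
    have h1 : t * u x ≤ t / c * u (act s x) := by
      rw [div_mul_eq_mul_div, le_div_iff₀ hc0]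
      nlinarith [hc s x]
    linarith
  · intro s x
    have h1 := hle (act s x)
    rw [← Finset.add_sum_erase _ _ (Finset.mem_univ (s.1, !s.2)), hact] at h1
    have h2 : ((Finset.univ.erase (s.1, !s.2)).card : ℝ) = q := by
      rw [Finset.card_erase_of_mem (Finset.mem_univ _), Finset.card_univ,
        Nat.cast_sub Fintype.card_pos, ← hq]
      simp
    rw [Finset.sum_sub_distrib, Finset.sum_const, nsmul_eq_mul, h2, inv_mul_eq_div,
      le_div_iff₀ ht0]
    nlinarith [hu (act s x), hu x, mul_le_mul_of_nonneg_right hlt (hu (act s x)).le]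

/-! ### Enumeration of reduced words. -/

variable [DecidableEq A]

/-- The words of length `n` which continue the letter `s` to a reduced word. -/
def reducedContinuations : ℕ → A × Bool → Finset (List (A × Bool))
  | 0, _ => {[]}
  | n + 1, s => (Finset.univ.erase (s.1, !s.2)).biUnion fun s' =>
      (reducedContinuations n s').image (List.cons s')

theorem mem_reducedContinuations {n : ℕ} {s : A × Bool} {w : List (A × Bool)} :
    w ∈ reducedContinuations n s ↔ w.length = n ∧ FreeGroup.IsReduced (s :: w) := by
  induction n generalizing s w with
  | zero =>
    simp only [reducedContinuations, Finset.mem_singleton, List.length_eq_zero_iff]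
    exact ⟨fun h => ⟨h, h ▸ FreeGroup.IsReduced.singleton⟩, fun h => h.1⟩
  | succ n ih =>
    simp only [reducedContinuations, Finset.mem_biUnion, Finset.mem_erase, Finset.mem_image]
    have hs : ∀ s' : A × Bool, s' ≠ (s.1, !s.2) ↔ (s.1 = s'.1 → s.2 = s'.2) := by
      rintro ⟨a, b⟩
      obtain ⟨a', b'⟩ := s
      rw [Ne, Prod.mk.injEq, not_and, eq_comm (a := a)]
      cases b <;> cases b' <;> simp
    constructor
    · rintro ⟨s', ⟨hs', -⟩, w', hw', rfl⟩
      obtain ⟨h1, h2⟩ := ih.1 hw'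
      exact ⟨by simp [h1], FreeGroup.isReduced_cons_cons.2 ⟨(hs s').1 hs', h2⟩⟩
    · rintro ⟨h1, h2⟩
      cases w with
      | nil => simp at h1
      | cons s' w' =>
        obtain ⟨h3, h4⟩ := FreeGroup.isReduced_cons_cons.1 h2
        exact ⟨s', ⟨(hs s').2 h3, Finset.mem_univ _⟩, w', ih.2 ⟨by simpa using h1, h4⟩, rfl⟩

theorem card_biUnion_image_cons {S : Type*} [DecidableEq S] (B : Finset S)
    (W : S → Finset (List S)) :
    (B.biUnion fun s => (W s).image (List.cons s)).card = ∑ s ∈ B, (W s).card := by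
  rw [Finset.card_biUnion]
  · exact Finset.sum_congr rfl fun s _ =>
      Finset.card_image_of_injective _ (List.cons_injective)
  · intro s _ s' _ hne
    rw [Function.onFun, Finset.disjoint_left]
    intro w hw hw'
    obtain ⟨v, _, rfl⟩ := Finset.mem_image.1 hw
    obtain ⟨v', _, h⟩ := Finset.mem_image.1 hw'
    exact hne (List.cons.inj h).1.symm

theorem card_filter_biUnion_image_cons {S : Type*} [DecidableEq S] (B : Finset S)
    (W : S → Finset (List S)) (p : List S → Prop) [DecidablePred p] :
    ((B.biUnion fun s => (W s).image (List.cons s)).filter p).card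
      = ∑ s ∈ B, ((W s).filter fun w => p (s :: w)).card := by
  rw [Finset.filter_biUnion, ← card_biUnion_image_cons]
  simp only [Finset.filter_image]

theorem card_reducedContinuations (n : ℕ) (s : A × Bool) :
    (reducedContinuations n s).card = (Fintype.card (A × Bool) - 1) ^ n := by
  induction n generalizing s with
  | zero => simp [reducedContinuations]
  | succ n ih =>
    rw [reducedContinuations, card_biUnion_image_cons]
    simp only [ih, Finset.sum_const, Finset.card_erase_of_mem (Finset.mem_univ _),
      Finset.card_univ, smul_eq_mul]
    rw [pow_succ']

/-- Removing the first letter gives the counts a recursion over continuations without backtracking,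
and `f` is a supersolution of it; `K` normalises the case of no letters left. -/
theorem card_filter_reducedContinuations_le [DecidableEq X] {f : A × Bool → X → ℝ} {r K : ℝ}
    (hr : 0 < r) (hK : 0 ≤ K) (hf0 : ∀ s x, 0 ≤ f s x) {x₀ : X}
    (hf : ∀ s x, ∑ s' ∈ Finset.univ.erase (s.1, !s.2), f s' (act s x) ≤ r * f s x)
    (hfK : ∀ s x, act s x = x₀ → 1 ≤ K * f s x) (n : ℕ) (s : A × Bool) (x : X) :
    (((reducedContinuations n s).filter
      fun w => w.foldl (fun y s => act s y) (act s x) = x₀).card : ℝ) ≤ K * r ^ n * f s x := by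
  induction n generalizing s x with
  | zero =>
    simp only [reducedContinuations, Finset.filter_singleton, List.foldl_nil]
    by_cases h : act s x = x₀
    · simpa [h] using hfK s x h
    · simpa [h] using mul_nonneg hK (hf0 s x)
  | succ n ih =>
    rw [reducedContinuations, card_filter_biUnion_image_cons]
    push_cast
    calc _ ≤ ∑ s' ∈ Finset.univ.erase (s.1, !s.2), K * r ^ n * f s' (act s x) :=
          Finset.sum_le_sum fun s' _ => ih s' (act s x)
      _ = K * r ^ n * ∑ s' ∈ Finset.univ.erase (s.1, !s.2), f s' (act s x) := by
          rw [Finset.mul_sum]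
      _ ≤ K * r ^ n * (r * f s x) := by gcongr; exact hf s x
      _ = _ := by ring

/-- The reduced words of length `n`. -/
def reducedWords (A : Type*) [Fintype A] [DecidableEq A] : ℕ → Finset (List (A × Bool))
  | 0 => {[]}
  | n + 1 => Finset.univ.biUnion fun s => (reducedContinuations n s).image (List.cons s)

theorem mem_reducedWords {n : ℕ} {w : List (A × Bool)} :
    w ∈ reducedWords A n ↔ w.length = n ∧ FreeGroup.IsReduced w := by
  cases n with
  | zero =>
    simp only [reducedWords, Finset.mem_singleton, List.length_eq_zero_iff]
    exact ⟨fun h => ⟨h, h ▸ FreeGroup.IsReduced.nil⟩, fun h => h.1⟩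
  | succ n =>
    simp only [reducedWords, Finset.mem_biUnion, Finset.mem_univ, true_and, Finset.mem_image,
      mem_reducedContinuations]
    constructor
    · rintro ⟨s, w', ⟨h1, h2⟩, rfl⟩
      exact ⟨by simp [h1], h2⟩
    · rintro ⟨h1, h2⟩
      cases w with
      | nil => simp at h1
      | cons s w' => exact ⟨s, w', ⟨by simpa using h1, h2⟩, rfl⟩

theorem pow_le_card_reducedWords [Nonempty A] (n : ℕ) :
    (Fintype.card (A × Bool) - 1) ^ n ≤ (reducedWords A n).card := by
  cases n with
  | zero => simp [reducedWords]
  | succ n =>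
    rw [reducedWords, card_biUnion_image_cons]
    simp only [card_reducedContinuations, Finset.sum_const, Finset.card_univ, smul_eq_mul]
    rw [pow_succ']
    exact Nat.mul_le_mul_right _ (Nat.sub_le _ _)

/-- If there is a positive function which is superharmonic up to a factor less than the number of
neighbours, then the proportion of the reduced words that return to a point decays
exponentially. -/
theorem exists_card_returning_le [DecidableEq X]
    (hact : ∀ s x, act (s.1, !s.2) (act s x) = x) [Nonempty A] (x₀ : X)
    {u : X → ℝ} (hu : ∀ x, 0 < u x) {l : ℝ}
    (hl : l < Fintype.card (A × Bool)) (hle : ∀ x, ∑ s, u (act s x) ≤ l * u x) :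
    ∃ C ρ : ℝ, 0 < C ∧ 0 < ρ ∧ ρ < 1 ∧ ∀ n,
      (((reducedWords A n).filter fun w => w.foldl (fun y s => act s y) x₀ = x₀).card : ℝ)
        ≤ C * ρ ^ n * (reducedWords A n).card := by
  have : Nonempty X := ⟨x₀⟩
  obtain ⟨f, r, ε, hr, hrq, hε, hfε, hf⟩ := exists_nonbacktracking_supersolution act hact hu
    (q := Fintype.card (A × Bool) - 1) (by ring) (by linarith) hle
  set q : ℝ := Fintype.card (A × Bool) - 1 with hq
  have hq0 : 0 < q := hr.trans hrq
  have hf0 : ∀ s x, 0 ≤ f s x := fun s x => (mul_pos hε (hu _)).le.trans (hfε s x)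
  set K : ℝ := (ε * u x₀)⁻¹ with hKdef
  have hK : 0 < K := inv_pos.2 (mul_pos hε (hu _))
  have hfK : ∀ s x, act s x = x₀ → 1 ≤ K * f s x := by
    intro s x h
    have := hfε s x
    rw [h] at this
    rw [hKdef, inv_mul_eq_div, le_div_iff₀ (mul_pos hε (hu _)), one_mul]
    exact this
  have hlow : ∀ n, q ^ n ≤ (reducedWords A n).card := by
    intro n
    have := pow_le_card_reducedWords (A := A) n
    have h : ((Fintype.card (A × Bool) - 1 : ℕ) : ℝ) = q := by
      rw [Nat.cast_sub Fintype.card_pos, Nat.cast_one]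
    rw [← h]
    exact_mod_cast this
  have hS0 : 0 ≤ ∑ s, f s x₀ := Finset.sum_nonneg fun s _ => hf0 s x₀
  -- The ratio compares the growth bounds of returning words and of all reduced words. Peeling off
  -- the first letter accounts for the division by `r`, and the summand 1 covers the empty word.
  refine ⟨1 + K * (∑ s, f s x₀) / r, r / q, by positivity, by positivity,
    (div_lt_one hq0).2 hrq, fun n => ?_⟩
  have key : (((reducedWords A n).filter fun w => w.foldl (fun y s => act s y) x₀ = x₀).card : ℝ)
      ≤ (1 + K * (∑ s, f s x₀) / r) * r ^ n := by
    cases n with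
    | zero =>
      have h1 : ((reducedWords A 0).filter
          fun w => w.foldl (fun y s => act s y) x₀ = x₀).card ≤ 1 :=
        (Finset.card_filter_le _ _).trans (by simp [reducedWords])
      have h2 : 0 ≤ K * (∑ s, f s x₀) / r := by positivity
      have h3 : (((reducedWords A 0).filter
          fun w => w.foldl (fun y s => act s y) x₀ = x₀).card : ℝ) ≤ 1 := by exact_mod_cast h1
      rw [pow_zero, mul_one]
      linarith
    | succ n =>
      rw [reducedWords, card_filter_biUnion_image_cons]
      push_cast
      calc _ ≤ ∑ s, K * r ^ n * f s x₀ := Finset.sum_le_sum fun s _ =>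
            card_filter_reducedContinuations_le act hr hK.le hf0 hf hfK n s x₀
        _ = K * (∑ s, f s x₀) / r * r ^ (n + 1) := by
            rw [← Finset.mul_sum, pow_succ]; field_simp
        _ ≤ _ := by
            gcongr
            linarith
  calc _ ≤ (1 + K * (∑ s, f s x₀) / r) * r ^ n := key
    _ = (1 + K * (∑ s, f s x₀) / r) * (r / q) ^ n * q ^ n := by
        rw [div_pow]; field_simp
    _ ≤ _ := by gcongr; exact hlow n

end NonBacktracking

/-! ### Words that fix a point of the induced space. -/

section Returning

variable {G : Type*} [Group G]

/-- The element represented by a letter or a formal inverse of a letter. -/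
def letterValue {A : Type*} (π : A → G) (s : A × Bool) : G := FreeGroup.lift π (FreeGroup.mk [s])

theorem lift_mk_cons {A : Type*} (π : A → G) (s : A × Bool) (w : List (A × Bool)) :
    FreeGroup.lift π (FreeGroup.mk (s :: w))
      = letterValue π s * FreeGroup.lift π (FreeGroup.mk w) := by
  rw [letterValue, ← map_mul, FreeGroup.mul_mk, List.singleton_append]

theorem letterValue_inverse {A : Type*} (π : A → G) (s : A × Bool) :
    letterValue π (s.1, !s.2) = (letterValue π s)⁻¹ := by
  rw [letterValue, letterValue, ← map_inv, FreeGroup.inv_mk]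
  rfl

/-- Reading a word letter by letter moves a point by the inverse of the element that the word
represents. -/
theorem foldl_letterValue_smul {A X : Type*} [MulAction G X] (π : A → G) (w : List (A × Bool))
    (x : X) : w.foldl (fun y s => (letterValue π s)⁻¹ • y) x
      = (FreeGroup.lift π (FreeGroup.mk w))⁻¹ • x := by
  induction w generalizing x with
  | nil => simp [← FreeGroup.one_eq_mk]
  | cons s w ih => rw [List.foldl_cons, ih, lift_mk_cons, mul_inv_rev, mul_smul]

/-- The words which fix a point of the space induced from a non-amenable quotient of a subgroup of
finite index are exponentially rare among the reduced words. -/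
theorem exists_card_stabilizer_le {H : Subgroup G} [H.FiniteIndex] {Q : Type*} [Group Q]
    (φ : H →* Q) (hφ : Function.Surjective φ) (hQ : ¬ IsAmenableGroup Q)
    {A : Type*} [Fintype A] [DecidableEq A] {π : A → G} (hπ : IsGeneratingFamily π)
    [DecidableEq (InducedSpace φ)] (x₀ : InducedSpace φ) :
    ∃ C ρ : ℝ, 0 < C ∧ 0 < ρ ∧ ρ < 1 ∧ ∀ n,
      (((reducedWords A n).filter fun w =>
        w.foldl (fun y s => (letterValue π s)⁻¹ • y) x₀ = x₀).card : ℝ)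
          ≤ C * ρ ^ n * (reducedWords A n).card := by
  obtain ⟨T, ι, hι, hT⟩ := InducedSpace.exists_doubling_injection φ hφ hQ
  have : Nonempty (InducedSpace φ) := ⟨x₀⟩
  have : MulAction.IsPretransitive G (InducedSpace φ) := ⟨InducedSpace.exists_smul φ hφ⟩
  obtain ⟨hA, u, l, hl, hu, hle⟩ := exists_superharmonic_of_doubling π hπ hι hT
  refine exists_card_returning_le (fun s x => (letterValue π s)⁻¹ • x) ?_ x₀ hu (l := l) ?_ ?_
  · intro s x
    rw [letterValue_inverse, inv_inv, smul_inv_smul]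
  · rw [Fintype.card_prod, Fintype.card_bool]
    push_cast
    linarith
  · intro x
    refine le_of_eq_of_le ?_ (hle x)
    -- Letters come with their inverses, so acting by the inverse merely permutes the summands.
    rw [Fintype.sum_prod_type]
    refine Finset.sum_congr rfl fun a _ => ?_
    simp [letterValue, add_comm]

end Returning

/-! ### Averages over length-invariant measures -/

section Average

variable {A : Type*} [Fintype A] [DecidableEq A]

theorem tsum_freeGroup_eq_tsum_sum_reducedWords (F : FreeGroup A → ℝ≥0∞) :
    ∑' v, F v = ∑' n, ∑ w ∈ reducedWords A n, F (FreeGroup.mk w) := by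
  have h1 : ∀ v, F v = ∑' n, if v.norm = n then F v else 0 := fun v => by
    rw [tsum_eq_single v.norm fun n hn => if_neg hn.symm, if_pos rfl]
  rw [tsum_congr h1, ENNReal.tsum_comm]
  refine tsum_congr fun n => ?_
  have hinj : Set.InjOn (FreeGroup.mk : List (A × Bool) → FreeGroup A) (reducedWords A n) := by
    intro w hw w' hw' h
    have := congrArg FreeGroup.toWord h
    rwa [FreeGroup.toWord_mk, FreeGroup.toWord_mk, (mem_reducedWords.1 hw).2.reduce_eq,
      (mem_reducedWords.1 hw').2.reduce_eq] at this
  rw [← Finset.sum_image (f := F) hinj, tsum_eq_sum (s := (reducedWords A n).image FreeGroup.mk)]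
  · refine Finset.sum_congr rfl fun v hv => ?_
    obtain ⟨w, hw, rfl⟩ := Finset.mem_image.1 hv
    rw [FreeGroup.norm, FreeGroup.toWord_mk, (mem_reducedWords.1 hw).2.reduce_eq,
      if_pos (mem_reducedWords.1 hw).1]
  · intro v hv
    refine if_neg fun h => hv (Finset.mem_image.2 ⟨v.toWord, ?_, FreeGroup.mk_toWord⟩)
    exact mem_reducedWords.2 ⟨h, FreeGroup.isReduced_toWord⟩

/-- A weight on a set of words has a bounded average relative to all length-invariant measures as
soon as its mean over every sphere is bounded. -/
theorem tsum_mul_le_of_isLengthInvariant {μ : PMF (FreeGroup A)} (hμ : IsLengthInvariant μ)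
    (p : List (A × Bool) → Prop) [DecidablePred p] (g : ℕ → ℝ≥0∞) {C : ℝ≥0∞}
    (hg : ∀ n, ((reducedWords A n).filter p).card * g n ≤ C * (reducedWords A n).card) :
    ∑' v : FreeGroup A, (if p v.toWord then g v.norm else 0) * μ v ≤ C := by
  have hC : C = C * ∑' v, μ v := by rw [μ.tsum_coe, mul_one]
  rw [hC, ← ENNReal.tsum_mul_left, tsum_freeGroup_eq_tsum_sum_reducedWords,
    tsum_freeGroup_eq_tsum_sum_reducedWords]
  refine ENNReal.tsum_le_tsum fun n => ?_
  have hw : ∀ w ∈ reducedWords A n, (FreeGroup.mk w).toWord = w ∧ (FreeGroup.mk w).norm = n := by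
    intro w hw
    have := (mem_reducedWords.1 hw).2.reduce_eq
    rw [FreeGroup.norm, FreeGroup.toWord_mk, this]
    exact ⟨rfl, (mem_reducedWords.1 hw).1⟩
  -- On each sphere the measure is a constant `m`, so only cardinalities matter.
  obtain ⟨m, hm⟩ : ∃ m, ∀ w ∈ reducedWords A n, μ (FreeGroup.mk w) = m := by
    rcases (reducedWords A n).eq_empty_or_nonempty with h | ⟨w₀, h₀⟩
    · exact ⟨0, by simp [h]⟩
    · exact ⟨μ (FreeGroup.mk w₀), fun w h => hμ _ _ ((hw w h).2.trans (hw w₀ h₀).2.symm)⟩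
  calc _ = ∑ w ∈ reducedWords A n, if p w then g n * m else 0 := by
        refine Finset.sum_congr rfl fun w h => ?_
        rw [(hw w h).1, (hw w h).2, hm w h, ite_mul, zero_mul]
    _ = ((reducedWords A n).filter p).card * g n * m := by
        rw [← Finset.sum_filter, Finset.sum_const, nsmul_eq_mul, mul_assoc]
    _ ≤ C * (reducedWords A n).card * m := mul_le_mul_left (hg n) m
    _ = ∑ w ∈ reducedWords A n, C * m := by
        rw [Finset.sum_const, nsmul_eq_mul]; ring
    _ = _ := Finset.sum_congr rfl fun w h => by rw [hm w h]

end Average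

/-- Subexponential growth is tested against the root `s = r ^ (1 / (L + 1))`, which absorbs the
linear stretching of the argument; `L + 1` also allows `L = 0`. -/
theorem IsSubexponential.exists_le_mul_pow {f : ℕ → ℝ≥0} (hf : IsSubexponential f) {r : ℝ}
    (hr : 1 < r) (L : ℕ) : ∃ K : ℝ≥0, ∀ n m : ℕ, m ≤ L * n → (f m : ℝ) ≤ K * r ^ n := by
  set s : ℝ := r ^ ((L + 1 : ℕ) : ℝ)⁻¹ with hs
  have hs1 : 1 < s := Real.one_lt_rpow hr (by positivity)
  have hsr : s ^ (L + 1) = r := Real.rpow_inv_natCast_pow (by linarith) (by omega)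
  obtain ⟨K, hK⟩ := (hf s hs1).bddAbove_range
  have hK0 : 0 ≤ K := (by positivity : (0 : ℝ) ≤ f 0 / s ^ 0).trans (hK ⟨0, rfl⟩)
  refine ⟨⟨K, hK0⟩, fun n m hm => ?_⟩
  have h1 : (f m : ℝ) ≤ K * s ^ m := by
    rw [← div_le_iff₀ (by positivity)]
    exact hK ⟨m, rfl⟩
  refine h1.trans ?_
  change K * s ^ m ≤ K * r ^ n
  rw [← hsr, ← pow_mul]
  have : m ≤ (L + 1) * n := hm.trans (Nat.mul_le_mul_right _ (Nat.le_succ L))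
  gcongr
  exact hs1.le

/-! ### Running times and simulation of machines -/

namespace MultiTapeTM

variable {X : Type*} (M : MultiTapeTM X)

theorem step_of_halted {c : M.Cfg} {b : Bool} (h : c.status = Sum.inr b) : M.step c = c := by
  simp only [step, h]

theorem step_status {c : M.Cfg} {q : M.State} (h : c.status = Sum.inl q) :
    (M.step c).status = (M.δ q fun i => (c.tape i).head).1 := by
  simp only [step, h]

theorem step_tape {c : M.Cfg} {q : M.State} (h : c.status = Sum.inl q) (i : Option M.Work) :
    (M.step c).tape i = M.act (c.tape i) ((M.δ q fun i => (c.tape i).head).2 i) := by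
  simp only [step, h]

theorem iterate_step_of_halted {c : M.Cfg} {b : Bool} (h : c.status = Sum.inr b) (t : ℕ) :
    M.step^[t] c = c :=
  Function.iterate_fixed (M.step_of_halted h) t

variable {M}

theorem HaltsWith.mono {w : List X} {b : Bool} {s t : ℕ} (h : M.HaltsWith w b s) (hst : s ≤ t) :
    M.HaltsWith w b t := by
  obtain ⟨k, rfl⟩ := Nat.exists_eq_add_of_le' hst
  unfold HaltsWith run at h ⊢
  rw [Function.iterate_add_apply, M.iterate_step_of_halted h, h]

theorem HaltsWith.unique {w : List X} {b b' : Bool} {s t : ℕ} (h : M.HaltsWith w b s)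
    (h' : M.HaltsWith w b' t) : b = b' := by
  have h1 := h.mono (le_max_left s t)
  have h2 := h'.mono (le_max_right s t)
  unfold HaltsWith at h1 h2
  exact Sum.inr.inj (h1.symm.trans h2)

theorem HaltsWith.time_le {w : List X} {b : Bool} {t : ℕ} (h : M.HaltsWith w b t) :
    M.time w ≤ t :=
  iInf₂_le t ⟨b, h⟩

open Classical in
theorem Decides.exists_time_eq {L : Language X} (h : M.Decides L) (w : List X) :
    ∃ t : ℕ, M.time w = t ∧ M.HaltsWith w (decide (w ∈ L)) t := by
  have hex : ∃ t, ∃ b, M.HaltsWith w b t := by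
    by_cases hw : w ∈ L
    · obtain ⟨t, ht⟩ := (h w).1 hw
      exact ⟨t, _, ht⟩
    · obtain ⟨t, ht⟩ := (h w).2 hw
      exact ⟨t, _, ht⟩
  obtain ⟨b, hb⟩ := Nat.find_spec hex
  refine ⟨Nat.find hex, le_antisymm hb.time_le ?_, ?_⟩
  · refine le_iInf₂ fun t ht => ?_
    exact_mod_cast Nat.find_min' hex ht
  · have : b = decide (w ∈ L) := by
      by_cases hw : w ∈ L
      · obtain ⟨t, ht⟩ := (h w).1 hw
        rw [hb.unique ht]
        simp [hw]
      · obtain ⟨t, ht⟩ := (h w).2 hw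
        rw [hb.unique ht]
        simp [hw]
    rwa [← this]

variable (M)

theorem act_stay (T : Turing.Tape M.Symbol) : M.act T (T.head, none) = T :=
  Turing.Tape.write_self T

variable {Y : Type*} (M₁ : MultiTapeTM Y)

theorem map_act (f : Turing.PointedMap M.Symbol M₁.Symbol) (T : Turing.Tape M.Symbol)
    (a : M.Symbol × Option Turing.Dir) :
    (M.act T a).map f = M₁.act (T.map f) (f a.1, a.2) := by
  obtain ⟨s, d⟩ := a
  cases d with
  | none => exact Turing.Tape.map_write f s T
  | some d =>
    exact (Turing.Tape.map_move f (T.write s) d).trans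
      (congrArg _ (Turing.Tape.map_write f s T))

/-- If `M` contains a copy of `M₁`, then it runs through a computation of `M₁` step by step until
it leaves the copy with the verdict of `M₁`, and does not change its other tapes. -/
theorem exists_iterate_step_of_simulates (st : M₁.State → M.State)
    (tp : Option M₁.Work → Option M.Work) (f : Turing.PointedMap M.Symbol M₁.Symbol)
    (exit : Bool → M.State ⊕ Bool)
    (hstatus : ∀ q r, (M.δ (st q) r).1
      = Sum.elim (fun q' => Sum.inl (st q')) exit (M₁.δ q fun i => f (r (tp i))).1)
    (hact : ∀ q r i, (f ((M.δ (st q) r).2 (tp i)).1, ((M.δ (st q) r).2 (tp i)).2)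
      = (M₁.δ q fun i => f (r (tp i))).2 i)
    (hother : ∀ q r j, j ∉ Set.range tp → (M.δ (st q) r).2 j = (r j, none))
    (t : ℕ) (c : M₁.Cfg) (C : M.Cfg) (q : M₁.State) (b : Bool) (hc : c.status = Sum.inl q)
    (hC : C.status = Sum.inl (st q)) (htape : ∀ i, (C.tape (tp i)).map f = c.tape i)
    (hhalt : (M₁.step^[t] c).status = Sum.inr b) :
    ∃ t' ≤ t, (M.step^[t'] C).status = exit b ∧
      ∀ j, j ∉ Set.range tp → (M.step^[t'] C).tape j = C.tape j := by
  induction t generalizing c C q with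
  | zero =>
    rw [Function.iterate_zero_apply, hc] at hhalt
    cases hhalt
  | succ t ih =>
    have hread : (fun i => f ((C.tape (tp i)).head)) = fun i => (c.tape i).head := by
      funext i
      rw [← htape i, Turing.Tape.map_fst]
    have hother' : ∀ j, j ∉ Set.range tp → (M.step C).tape j = C.tape j := by
      intro j hj
      rw [M.step_tape hC, hother _ _ _ hj, act_stay]
    have hst : (M.step C).status
        = Sum.elim (fun q' => Sum.inl (st q')) exit (M₁.step c).status := by
      rw [M.step_status hC, hstatus, hread, M₁.step_status hc]
    rw [Function.iterate_succ_apply] at hhalt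
    rcases hq : (M₁.step c).status with q' | b'
    · obtain ⟨t', ht', h1, h2⟩ := ih (M₁.step c) (M.step C) q' hq (by rw [hst, hq]; rfl)
        (fun i => by
          rw [M.step_tape hC, M.map_act M₁, hact, hread, htape, M₁.step_tape hc]) hhalt
      refine ⟨t' + 1, by omega, by rwa [Function.iterate_succ_apply], fun j hj => ?_⟩
      rw [Function.iterate_succ_apply, h2 j hj, hother' j hj]
    · rw [M₁.iterate_step_of_halted hq, hq] at hhalt
      cases hhalt
      exact ⟨1, by omega, by rw [Function.iterate_one, hst, hq]; rfl, fun j hj => hother' j hj⟩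

end MultiTapeTM

/-! ### Writing words leftwards -/

/-- The tape on which the word `l` has been written leftwards: its head is on the blank to the left
of `l`. -/
def pushTape {Γ : Type*} [Inhabited Γ] (l : List Γ) : Turing.Tape Γ :=
  ⟨default, Turing.ListBlank.mk [], Turing.ListBlank.mk l⟩

theorem mk_default {Γ : Type*} [Inhabited Γ] :
    (Turing.ListBlank.mk [] : Turing.ListBlank Γ).cons default = Turing.ListBlank.mk [] :=
  Turing.ListBlank.cons_head_tail (Turing.ListBlank.mk [])

theorem pushTape_nil {Γ : Type*} [Inhabited Γ] :
    (pushTape [] : Turing.Tape Γ) = Turing.Tape.mk₁ [] := rfl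

/-- Writing leftwards leaves the head next to the first letter, so one move restores an initial tape
and no rewinding is needed. The price is that transducer outputs are prepended. -/
theorem pushTape_move_right {Γ : Type*} [Inhabited Γ] (l : List Γ) :
    (pushTape l).move Turing.Dir.right = Turing.Tape.mk₁ l := by
  simp only [pushTape, Turing.Tape.move, mk_default]
  rfl

/-! ### Transducing a word and running two machines in succession -/

/-- A finite-state transducer which prepends the words it emits to its two outputs. -/
structure PrependTransducer (X Y₁ Y₂ : Type*) where
  /-- the states -/
  State : Type
  finiteState : Finite State
  next : State → X → State
  out₁ : State → X → List Y₁
  out₂ : State → X → List Y₂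

namespace PrependTransducer

variable {X Y₁ Y₂ : Type*} (D : PrependTransducer X Y₁ Y₂)

/-- One letter of the input is read. -/
def stepOn (c : D.State × List Y₁ × List Y₂) (x : X) : D.State × List Y₁ × List Y₂ :=
  (D.next c.1 x, D.out₁ c.1 x ++ c.2.1, D.out₂ c.1 x ++ c.2.2)

/-- The final state and the outputs on the word `w`, read from the state `i`. -/
def eval (i : D.State) (w : List X) : D.State × List Y₁ × List Y₂ :=
  w.foldl D.stepOn (i, [], [])

theorem eval_append_singleton (i : D.State) (w : List X) (x : X) :
    D.eval i (w ++ [x]) = D.stepOn (D.eval i w) x := by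
  rw [eval, List.foldl_append]
  rfl

theorem length_eval_le {L : ℕ} (h₁ : ∀ i x, (D.out₁ i x).length ≤ L)
    (h₂ : ∀ i x, (D.out₂ i x).length ≤ L) (i : D.State) (w : List X) :
    (D.eval i w).2.1.length ≤ L * w.length ∧ (D.eval i w).2.2.length ≤ L * w.length := by
  induction w using List.reverseRecOn with
  | nil => simp [eval]
  | append_singleton w x ih =>
    rw [eval_append_singleton]
    have := h₁ (D.eval i w).1 x
    have := h₂ (D.eval i w).1 x
    simp only [stepOn, List.length_append, List.length_singleton,
      Nat.mul_add, mul_one]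
    omega

end PrependTransducer

namespace MultiTapeTM

section Sequential

variable {X Y₁ Y₂ : Type*} [Finite X] (D : PrependTransducer X Y₁ Y₂) (i₀ : D.State) (L : ℕ)
  (M₁ : MultiTapeTM Y₁) (M₂ : MultiTapeTM Y₂)

/-- The tape alphabet of `sequential`. -/
abbrev SeqSymbol (X : Type*) [Finite X] {Y₁ Y₂ : Type*} (M₁ : MultiTapeTM Y₁)
    (M₂ : MultiTapeTM Y₂) : Type :=
  Option (Fin (Nat.card X)) × M₁.Symbol × M₂.Symbol

/-- The states of `sequential`: it transduces the input, runs `M₁` or runs `M₂`. -/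
abbrev SeqState {X Y₁ Y₂ : Type*} (D : PrependTransducer X Y₁ Y₂) (L : ℕ) (M₁ : MultiTapeTM Y₁)
    (M₂ : MultiTapeTM Y₂) : Type :=
  (D.State × Fin (L + 1)) ⊕ M₁.State ⊕ M₂.State

/-- The actions while a letter is being transduced: the next letters of the outputs, if there are
any, are written leftwards. -/
def seqEmit (y₁ : Option Y₁) (y₂ : Option Y₂)
    (r : Option (Option M₁.Work ⊕ Option M₂.Work) → SeqSymbol X M₁ M₂) :
    Option (Option M₁.Work ⊕ Option M₂.Work) → SeqSymbol X M₁ M₂ × Option Turing.Dir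
  | some (Sum.inl none) => y₁.elim (r (some (Sum.inl none)), none) fun y =>
      ((none, M₁.letter y, default), some Turing.Dir.left)
  | some (Sum.inr none) => y₂.elim (r (some (Sum.inr none)), none) fun y =>
      ((none, default, M₂.letter y), some Turing.Dir.left)
  | j => (r j, none)

/-- The actions when the whole input has been transduced. -/
def seqStart (r : Option (Option M₁.Work ⊕ Option M₂.Work) → SeqSymbol X M₁ M₂) :
    Option (Option M₁.Work ⊕ Option M₂.Work) → SeqSymbol X M₁ M₂ × Option Turing.Dir
  | some (Sum.inl none) => (r (some (Sum.inl none)), some Turing.Dir.right)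
  | some (Sum.inr none) => (r (some (Sum.inr none)), some Turing.Dir.right)
  | j => (r j, none)

open Classical in
/-- The transition function of `sequential`. -/
noncomputable def seqTransition : SeqState D L M₁ M₂ →
    (Option (Option M₁.Work ⊕ Option M₂.Work) → SeqSymbol X M₁ M₂) →
    (SeqState D L M₁ M₂ ⊕ Bool) × (Option (Option M₁.Work ⊕ Option M₂.Work) →
      SeqSymbol X M₁ M₂ × Option Turing.Dir)
  | Sum.inl (i, j), r =>
    match (r none).1 with
    | none => if i = i₀ then (Sum.inl (Sum.inr (Sum.inl M₁.start)), seqStart M₁ M₂ r)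
        else (Sum.inr false, fun j => (r j, none))
    | some k =>
      -- The counter gives every letter exactly `L + 1` steps, `L` for emission and one for
      -- advancing. Emitted words are reversed because they are written leftwards.
      if h : j.1 < L then
        (Sum.inl (Sum.inl (i, ⟨j.1 + 1, Nat.succ_lt_succ h⟩)),
          seqEmit M₁ M₂ (D.out₁ i ((Finite.equivFin X).symm k)).reverse[j.1]?
            (D.out₂ i ((Finite.equivFin X).symm k)).reverse[j.1]? r)
      else (Sum.inl (Sum.inl (D.next i ((Finite.equivFin X).symm k), 0)),
          fun j => (r j, if j = none then some Turing.Dir.right else none))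
  | Sum.inr (Sum.inl q), r =>
    let a := M₁.δ q fun j => (r (some (Sum.inl j))).2.1
    (Sum.elim (fun q' => Sum.inl (Sum.inr (Sum.inl q')))
      (fun b => if b then Sum.inl (Sum.inr (Sum.inr M₂.start)) else Sum.inr false) a.1,
      fun
      | some (Sum.inl j) => ((none, (a.2 j).1, default), (a.2 j).2)
      | j => (r j, none))
  | Sum.inr (Sum.inr q), r =>
    let a := M₂.δ q fun j => (r (some (Sum.inr j))).2.2
    (Sum.elim (fun q' => Sum.inl (Sum.inr (Sum.inr q'))) Sum.inr a.1,
      fun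
      | some (Sum.inr j) => ((none, default, (a.2 j).1), (a.2 j).2)
      | j => (r j, none))

section Transition

variable {D i₀ L M₁ M₂} {r : Option (Option M₁.Work ⊕ Option M₂.Work) → SeqSymbol X M₁ M₂}
  {i : D.State} {x : X}

theorem seqTransition_emit {j : Fin (L + 1)} (hr : (r none).1 = some (Finite.equivFin X x))
    (hj : j.1 < L) : seqTransition D i₀ L M₁ M₂ (Sum.inl (i, j)) r
      = (Sum.inl (Sum.inl (i, ⟨j.1 + 1, Nat.succ_lt_succ hj⟩)),
        seqEmit M₁ M₂ (D.out₁ i x).reverse[j.1]? (D.out₂ i x).reverse[j.1]? r) := by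
  simp only [seqTransition, hr, Equiv.symm_apply_apply, dif_pos hj]

theorem seqTransition_next (hr : (r none).1 = some (Finite.equivFin X x)) :
    seqTransition D i₀ L M₁ M₂ (Sum.inl (i, Fin.last L)) r
      = (Sum.inl (Sum.inl (D.next i x, 0)),
        fun t => (r t, if t = none then some Turing.Dir.right else none)) := by
  simp only [seqTransition, hr, Equiv.symm_apply_apply, Fin.val_last, lt_irrefl, dif_neg,
    not_false_eq_true]

theorem seqTransition_start {j : Fin (L + 1)} (hr : (r none).1 = none) :
    seqTransition D i₀ L M₁ M₂ (Sum.inl (i₀, j)) r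
      = (Sum.inl (Sum.inr (Sum.inl M₁.start)), seqStart M₁ M₂ r) := by
  simp only [seqTransition, hr, if_true]

theorem seqTransition_reject {j : Fin (L + 1)} (hr : (r none).1 = none) (hi : i ≠ i₀) :
    (seqTransition D i₀ L M₁ M₂ (Sum.inl (i, j)) r).1 = Sum.inr false := by
  simp only [seqTransition, hr, if_neg hi]

end Transition

/-- The machine that transduces its input by `D`, rejects unless the final state is `i₀`, runs `M₁`
on the first output, rejects if `M₁` does so, and otherwise runs `M₂` on the second output. -/
noncomputable def sequential : MultiTapeTM X where
  Work := Option M₁.Work ⊕ Option M₂.Work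
  Symbol := SeqSymbol X M₁ M₂
  State := SeqState D L M₁ M₂
  finiteWork := by
    have := M₁.finiteWork
    have := M₂.finiteWork
    infer_instance
  finiteSymbol := by
    have := M₁.finiteSymbol
    have := M₂.finiteSymbol
    infer_instance
  finiteState := by
    have := D.finiteState
    have := M₁.finiteState
    have := M₂.finiteState
    infer_instance
  inhabitedSymbol := inferInstance
  start := Sum.inl (i₀, 0)
  letter := ⟨fun x => (some (Finite.equivFin X x), default, default), fun x y h => by
    simpa using h⟩
  letter_ne_blank x h := by
    have := congrArg Prod.fst h
    cases this
  δ := seqTransition D i₀ L M₁ M₂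

/-- The symbols of `M₁` on the tapes of `sequential`. -/
def seqProj₁ : Turing.PointedMap (sequential D i₀ L M₁ M₂).Symbol M₁.Symbol :=
  ⟨fun s => s.2.1, rfl⟩

/-- The symbols of `M₂` on the tapes of `sequential`. -/
def seqProj₂ : Turing.PointedMap (sequential D i₀ L M₁ M₂).Symbol M₂.Symbol :=
  ⟨fun s => s.2.2, rfl⟩

/-- The work tapes of `sequential` used by `M₁` hold the word `l` written leftwards. -/
def SeqTapes₁ (C : (sequential D i₀ L M₁ M₂).Cfg) (l : List Y₁) : Prop :=
  (C.tape (some (Sum.inl none))).map (seqProj₁ D i₀ L M₁ M₂) = pushTape (l.map M₁.letter) ∧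
    ∀ j, (C.tape (some (Sum.inl (some j)))).map (seqProj₁ D i₀ L M₁ M₂) = Turing.Tape.mk₁ []

/-- The work tapes of `sequential` used by `M₂` hold the word `l` written leftwards. -/
def SeqTapes₂ (C : (sequential D i₀ L M₁ M₂).Cfg) (l : List Y₂) : Prop :=
  (C.tape (some (Sum.inr none))).map (seqProj₂ D i₀ L M₁ M₂) = pushTape (l.map M₂.letter) ∧
    ∀ j, (C.tape (some (Sum.inr (some j)))).map (seqProj₂ D i₀ L M₁ M₂) = Turing.Tape.mk₁ []

/-- `sequential` is in the course of transducing: the word `w` has not been read yet, and the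
outputs so far are `l₁` and `l₂`. -/
structure SeqScanning (C : (sequential D i₀ L M₁ M₂).Cfg) (i : D.State) (j : Fin (L + 1))
    (w : List X) (l₁ : List Y₁) (l₂ : List Y₂) : Prop where
  status : C.status = Sum.inl (Sum.inl (i, j))
  input : ∃ T, C.tape none = Turing.Tape.mk' T
    (Turing.ListBlank.mk (w.map (sequential D i₀ L M₁ M₂).letter))
  tapes₁ : SeqTapes₁ D i₀ L M₁ M₂ C l₁
  tapes₂ : SeqTapes₂ D i₀ L M₁ M₂ C l₂

theorem seqScanning_init (w : List X) :
    SeqScanning D i₀ L M₁ M₂ ((sequential D i₀ L M₁ M₂).init w) i₀ 0 w [] [] where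
  status := rfl
  input := ⟨_, rfl⟩
  tapes₁ := ⟨by rw [List.map_nil, pushTape_nil]; exact Turing.Tape.map_mk₁ _ _,
    fun _ => Turing.Tape.map_mk₁ _ _⟩
  tapes₂ := ⟨by rw [List.map_nil, pushTape_nil]; exact Turing.Tape.map_mk₁ _ _,
    fun _ => Turing.Tape.map_mk₁ _ _⟩

variable {D i₀ L M₁ M₂} {C : (sequential D i₀ L M₁ M₂).Cfg} {i : D.State} {j : Fin (L + 1)}
  {x : X} {w : List X} {l₁ : List Y₁} {l₂ : List Y₂}

theorem SeqScanning.head (h : SeqScanning D i₀ L M₁ M₂ C i j (x :: w) l₁ l₂) :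
    (C.tape none).head.1 = some (Finite.equivFin X x) := by
  obtain ⟨T, hT⟩ := h.input
  rw [hT]
  rfl

theorem SeqScanning.head_nil (h : SeqScanning D i₀ L M₁ M₂ C i j [] l₁ l₂) :
    (C.tape none).head.1 = none := by
  obtain ⟨T, hT⟩ := h.input
  rw [hT]
  rfl

theorem SeqScanning.step_emit (h : SeqScanning D i₀ L M₁ M₂ C i j (x :: w) l₁ l₂)
    (hj : j.1 < L) :
    SeqScanning D i₀ L M₁ M₂ ((sequential D i₀ L M₁ M₂).step C) i ⟨j.1 + 1, Nat.succ_lt_succ hj⟩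
      (x :: w) ((D.out₁ i x).reverse[j.1]?.toList ++ l₁)
      ((D.out₂ i x).reverse[j.1]?.toList ++ l₂) := by
  have hδ : (sequential D i₀ L M₁ M₂).δ (Sum.inl (i, j)) (fun t => (C.tape t).head)
      = (Sum.inl (Sum.inl (i, ⟨j.1 + 1, Nat.succ_lt_succ hj⟩)),
        seqEmit M₁ M₂ (D.out₁ i x).reverse[j.1]? (D.out₂ i x).reverse[j.1]?
          (fun t => (C.tape t).head)) :=
    seqTransition_emit (D := D) (i₀ := i₀) (L := L) (M₁ := M₁) (M₂ := M₂)
      (r := fun t => (C.tape t).head) h.head hj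
  have ht := (sequential D i₀ L M₁ M₂).step_tape h.status
  rw [hδ] at ht
  refine ⟨?_, ?_, ⟨?_, fun t => ?_⟩, ⟨?_, fun t => ?_⟩⟩
  · rw [step_status _ h.status, hδ]
  · obtain ⟨T, hT⟩ := h.input
    exact ⟨T, (ht none).trans ((act_stay _ _).trans hT)⟩
  · rw [ht, map_act _ M₁, h.tapes₁.1]
    cases (D.out₁ i x).reverse[j.1]? with
    | none =>
      refine Eq.trans (congrArg (M₁.act _) ?_) (M₁.act_stay _)
      rw [← h.tapes₁.1]
      rfl
    | some y => rfl
  · rw [ht]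
    exact (congrArg _ (act_stay _ _)).trans (h.tapes₁.2 t)
  · rw [ht, map_act _ M₂, h.tapes₂.1]
    cases (D.out₂ i x).reverse[j.1]? with
    | none =>
      refine Eq.trans (congrArg (M₂.act _) ?_) (M₂.act_stay _)
      rw [← h.tapes₂.1]
      rfl
    | some y => rfl
  · rw [ht]
    exact (congrArg _ (act_stay _ _)).trans (h.tapes₂.2 t)

theorem reverse_drop_append {Y : Type*} (l l' : List Y) (j : ℕ) : (l.drop j).reverse ++ l'
    = (l.drop (j + 1)).reverse ++ (l[j]?.toList ++ l') := by
  by_cases hl : j < l.length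
  · rw [List.drop_eq_getElem_cons hl, List.getElem?_eq_getElem hl]
    simp [-List.drop_succ_cons, -List.getElem_cons_drop]
  · rw [List.drop_of_length_le (by omega), List.drop_of_length_le (by omega),
      List.getElem?_eq_none (by omega)]
    simp

theorem SeqScanning.iterate_step_emit
    (h₁ : (D.out₁ i x).length ≤ L) (h₂ : (D.out₂ i x).length ≤ L) (d : ℕ) :
    ∀ (C : (sequential D i₀ L M₁ M₂).Cfg) (j : Fin (L + 1)) (l₁ : List Y₁) (l₂ : List Y₂),
      SeqScanning D i₀ L M₁ M₂ C i j (x :: w) l₁ l₂ → j.1 + d = L →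
      SeqScanning D i₀ L M₁ M₂ ((sequential D i₀ L M₁ M₂).step^[d] C) i (Fin.last L) (x :: w)
        (((D.out₁ i x).reverse.drop j.1).reverse ++ l₁)
        (((D.out₂ i x).reverse.drop j.1).reverse ++ l₂) := by
  induction d with
  | zero =>
    intro C j l₁ l₂ h hj
    have hj' : j = Fin.last L := Fin.ext (by simpa using hj)
    subst hj'
    rw [List.drop_of_length_le (by simpa using h₁), List.drop_of_length_le (by simpa using h₂)]
    exact h
  | succ d ih =>
    intro C j l₁ l₂ h hj
    have hjL : j.1 < L := by omega
    have := ih _ _ _ _ (h.step_emit hjL) (by simp only; omega)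
    rw [← Function.iterate_succ_apply] at this
    rw [reverse_drop_append (D.out₁ i x).reverse, reverse_drop_append (D.out₂ i x).reverse]
    exact this

theorem SeqScanning.step_next (h : SeqScanning D i₀ L M₁ M₂ C i (Fin.last L) (x :: w) l₁ l₂) :
    SeqScanning D i₀ L M₁ M₂ ((sequential D i₀ L M₁ M₂).step C) (D.next i x) 0 w l₁ l₂ := by
  have hδ : (sequential D i₀ L M₁ M₂).δ (Sum.inl (i, Fin.last L)) (fun t => (C.tape t).head)
      = (Sum.inl (Sum.inl (D.next i x, 0)),
        fun t => ((C.tape t).head, if t = none then some Turing.Dir.right else none)) :=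
    seqTransition_next (D := D) (i₀ := i₀) (L := L) (M₁ := M₁) (M₂ := M₂)
      (r := fun t => (C.tape t).head) h.head
  have ht := (sequential D i₀ L M₁ M₂).step_tape h.status
  rw [hδ] at ht
  have hts : ∀ t : Option M₁.Work ⊕ Option M₂.Work,
      ((sequential D i₀ L M₁ M₂).step C).tape (some t) = C.tape (some t) := fun t =>
    (ht (some t)).trans (act_stay _ _)
  refine ⟨?_, ?_, ⟨?_, fun t => ?_⟩, ⟨?_, fun t => ?_⟩⟩
  · rw [step_status _ h.status, hδ]
  · obtain ⟨T, hT⟩ := h.input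
    refine ⟨T.cons ((sequential D i₀ L M₁ M₂).letter x), (ht none).trans ?_⟩
    refine (congrArg (Turing.Tape.move Turing.Dir.right) (Turing.Tape.write_self _)).trans ?_
    rw [hT]
    exact Turing.Tape.move_right_mk' _ _
  · exact (congrArg _ (hts _)).trans h.tapes₁.1
  · exact (congrArg _ (hts _)).trans (h.tapes₁.2 t)
  · exact (congrArg _ (hts _)).trans h.tapes₂.1
  · exact (congrArg _ (hts _)).trans (h.tapes₂.2 t)

theorem SeqScanning.iterate_step_letter
    (h₁ : (D.out₁ i x).length ≤ L) (h₂ : (D.out₂ i x).length ≤ L)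
    (h : SeqScanning D i₀ L M₁ M₂ C i 0 (x :: w) l₁ l₂) :
    SeqScanning D i₀ L M₁ M₂ ((sequential D i₀ L M₁ M₂).step^[L + 1] C) (D.next i x) 0 w
      (D.out₁ i x ++ l₁) (D.out₂ i x ++ l₂) := by
  have := (SeqScanning.iterate_step_emit h₁ h₂ L C 0 l₁ l₂ h (by simp)).step_next
  rw [← Function.iterate_succ_apply' (sequential D i₀ L M₁ M₂).step] at this
  simpa using this

theorem SeqScanning.iterate_step_word
    (h₁ : ∀ i x, (D.out₁ i x).length ≤ L) (h₂ : ∀ i x, (D.out₂ i x).length ≤ L) :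
    ∀ (w : List X) (C : (sequential D i₀ L M₁ M₂).Cfg) (c : D.State × List Y₁ × List Y₂),
      SeqScanning D i₀ L M₁ M₂ C c.1 0 w c.2.1 c.2.2 →
      SeqScanning D i₀ L M₁ M₂ ((sequential D i₀ L M₁ M₂).step^[(L + 1) * w.length] C)
        (w.foldl D.stepOn c).1 0 [] (w.foldl D.stepOn c).2.1 (w.foldl D.stepOn c).2.2 := by
  intro w
  induction w with
  | nil => exact fun C c h => h
  | cons x w ih =>
    intro C c h
    have := ih _ (D.stepOn c x) (h.iterate_step_letter (h₁ _ _) (h₂ _ _))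
    rw [← Function.iterate_add_apply] at this
    rw [List.length_cons, Nat.mul_succ]
    exact this

theorem SeqScanning.status_step_of_ne (h : SeqScanning D i₀ L M₁ M₂ C i j [] l₁ l₂)
    (hi : i ≠ i₀) : ((sequential D i₀ L M₁ M₂).step C).status = Sum.inr false := by
  rw [step_status _ h.status]
  exact seqTransition_reject h.head_nil hi

theorem SeqScanning.step_start (h : SeqScanning D i₀ L M₁ M₂ C i₀ j [] l₁ l₂) :
    ((sequential D i₀ L M₁ M₂).step C).status = Sum.inl (Sum.inr (Sum.inl M₁.start)) ∧
    (∀ t, (((sequential D i₀ L M₁ M₂).step C).tape (some (Sum.inl t))).map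
      (seqProj₁ D i₀ L M₁ M₂) = (M₁.init l₁).tape t) ∧
    (∀ t, (((sequential D i₀ L M₁ M₂).step C).tape (some (Sum.inr t))).map
      (seqProj₂ D i₀ L M₁ M₂) = (M₂.init l₂).tape t) := by
  have hδ : (sequential D i₀ L M₁ M₂).δ (Sum.inl (i₀, j)) (fun t => (C.tape t).head)
      = (Sum.inl (Sum.inr (Sum.inl M₁.start)), seqStart M₁ M₂ fun t => (C.tape t).head) :=
    seqTransition_start (D := D) (i₀ := i₀) (L := L) (M₁ := M₁) (M₂ := M₂)
      (r := fun t => (C.tape t).head) h.head_nil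
  have ht := (sequential D i₀ L M₁ M₂).step_tape h.status
  rw [hδ] at ht
  refine ⟨by rw [step_status _ h.status, hδ], fun t => ?_, fun t => ?_⟩
  · rw [ht]
    cases t with
    | none =>
      refine (congrArg (Turing.Tape.map _) (congrArg (Turing.Tape.move Turing.Dir.right)
        (Turing.Tape.write_self _))).trans ?_
      rw [Turing.Tape.map_move, h.tapes₁.1, pushTape_move_right]
      rfl
    | some t => exact (congrArg _ (act_stay _ _)).trans (h.tapes₁.2 t)
  · rw [ht]
    cases t with
    | none =>
      refine (congrArg (Turing.Tape.map _) (congrArg (Turing.Tape.move Turing.Dir.right)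
        (Turing.Tape.write_self _))).trans ?_
      rw [Turing.Tape.map_move, h.tapes₂.1, pushTape_move_right]
      rfl
    | some t => exact (congrArg _ (act_stay _ _)).trans (h.tapes₂.2 t)

theorem exists_iterate_step_run₁ {b : Bool} {t : ℕ} {w : List Y₁}
    (hC : C.status = Sum.inl (Sum.inr (Sum.inl M₁.start)))
    (htape : ∀ t, (C.tape (some (Sum.inl t))).map (seqProj₁ D i₀ L M₁ M₂) = (M₁.init w).tape t)
    (hhalt : M₁.HaltsWith w b t) :
    ∃ t' ≤ t, ((sequential D i₀ L M₁ M₂).step^[t'] C).status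
        = (if b then Sum.inl (Sum.inr (Sum.inr M₂.start)) else Sum.inr false) ∧
      ∀ s, ((sequential D i₀ L M₁ M₂).step^[t'] C).tape (some (Sum.inr s))
        = C.tape (some (Sum.inr s)) := by
  obtain ⟨t', ht', h1, h2⟩ := exists_iterate_step_of_simulates (sequential D i₀ L M₁ M₂) M₁
    (fun q => Sum.inr (Sum.inl q)) (fun t => some (Sum.inl t)) (seqProj₁ D i₀ L M₁ M₂)
    (fun b => if b then Sum.inl (Sum.inr (Sum.inr M₂.start)) else Sum.inr false)
    (fun _ _ => rfl) (fun _ _ _ => rfl)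
    (fun q r j hj => by
      rcases j with _ | j | j
      · rfl
      · exact (hj ⟨j, rfl⟩).elim
      · rfl) t (M₁.init w) C M₁.start b rfl hC htape hhalt
  exact ⟨t', ht', h1, fun s => h2 _ (by rintro ⟨_, h⟩; cases h)⟩

theorem exists_iterate_step_run₂ {b : Bool} {t : ℕ} {w : List Y₂}
    (hC : C.status = Sum.inl (Sum.inr (Sum.inr M₂.start)))
    (htape : ∀ t, (C.tape (some (Sum.inr t))).map (seqProj₂ D i₀ L M₁ M₂) = (M₂.init w).tape t)
    (hhalt : M₂.HaltsWith w b t) :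
    ∃ t' ≤ t, ((sequential D i₀ L M₁ M₂).step^[t'] C).status = Sum.inr b := by
  obtain ⟨t', ht', h1, -⟩ := exists_iterate_step_of_simulates (sequential D i₀ L M₁ M₂) M₂
    (fun q => Sum.inr (Sum.inr q)) (fun t => some (Sum.inr t)) (seqProj₂ D i₀ L M₁ M₂)
    Sum.inr (fun _ _ => rfl) (fun _ _ _ => rfl)
    (fun q r j hj => by
      rcases j with _ | j | j
      · rfl
      · rfl
      · exact (hj ⟨j, rfl⟩).elim) t (M₂.init w) C M₂.start b rfl hC htape hhalt
  exact ⟨t', ht', h1⟩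

variable (i₀ M₁ M₂)

theorem haltsWith_sequential_of_ne
    (h₁ : ∀ i x, (D.out₁ i x).length ≤ L) (h₂ : ∀ i x, (D.out₂ i x).length ≤ L)
    (hw : (D.eval i₀ w).1 ≠ i₀) :
    (sequential D i₀ L M₁ M₂).HaltsWith w false ((L + 1) * w.length + 1) := by
  have h := SeqScanning.iterate_step_word h₁ h₂ w _ (i₀, [], [])
    (seqScanning_init D i₀ L M₁ M₂ w)
  rw [HaltsWith, run, Function.iterate_succ_apply']
  exact h.status_step_of_ne hw

/-- Running `M₁` leaves the tapes of `M₂` alone, so they still form an initial configuration if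
control passes to `M₂`. -/
theorem exists_run_sequential_start
    (h₁ : ∀ i x, (D.out₁ i x).length ≤ L) (h₂ : ∀ i x, (D.out₂ i x).length ≤ L)
    (hw : (D.eval i₀ w).1 = i₀) {b : Bool} {t : ℕ}
    (ht : M₁.HaltsWith (D.eval i₀ w).2.1 b t) :
    ∃ t' ≤ t, ((sequential D i₀ L M₁ M₂).run w (t' + ((L + 1) * w.length + 1))).status
        = (if b then Sum.inl (Sum.inr (Sum.inr M₂.start)) else Sum.inr false) ∧
      ∀ s, (((sequential D i₀ L M₁ M₂).run w (t' + ((L + 1) * w.length + 1))).tape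
        (some (Sum.inr s))).map (seqProj₂ D i₀ L M₁ M₂)
          = (M₂.init (D.eval i₀ w).2.2).tape s := by
  have h := SeqScanning.iterate_step_word h₁ h₂ w _ (i₀, [], [])
    (seqScanning_init D i₀ L M₁ M₂ w)
  have hw' : (w.foldl D.stepOn (i₀, [], [])).1 = i₀ := hw
  rw [hw'] at h
  obtain ⟨hs, ht₁, ht₂⟩ := h.step_start
  rw [← Function.iterate_succ_apply' (sequential D i₀ L M₁ M₂).step] at hs ht₁ ht₂
  obtain ⟨t', ht', h3, h4⟩ := exists_iterate_step_run₁ hs ht₁ ht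
  rw [← Function.iterate_add_apply] at h3 h4
  refine ⟨t', ht', h3, fun s => ?_⟩
  rw [run, h4]
  exact ht₂ s

theorem haltsWith_sequential_of_reject
    (h₁ : ∀ i x, (D.out₁ i x).length ≤ L) (h₂ : ∀ i x, (D.out₂ i x).length ≤ L)
    (hw : (D.eval i₀ w).1 = i₀) {t : ℕ} (ht : M₁.HaltsWith (D.eval i₀ w).2.1 false t) :
    (sequential D i₀ L M₁ M₂).HaltsWith w false ((L + 1) * w.length + 1 + t) := by
  obtain ⟨t', ht', h, -⟩ := exists_run_sequential_start i₀ M₁ M₂ h₁ h₂ hw ht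
  exact HaltsWith.mono (s := t' + ((L + 1) * w.length + 1)) h (by omega)

theorem haltsWith_sequential_of_accept
    (h₁ : ∀ i x, (D.out₁ i x).length ≤ L) (h₂ : ∀ i x, (D.out₂ i x).length ≤ L)
    (hw : (D.eval i₀ w).1 = i₀) {t s : ℕ} (ht : M₁.HaltsWith (D.eval i₀ w).2.1 true t)
    {b : Bool} (hs : M₂.HaltsWith (D.eval i₀ w).2.2 b s) :
    (sequential D i₀ L M₁ M₂).HaltsWith w b ((L + 1) * w.length + 1 + t + s) := by
  obtain ⟨t', ht', h, htape⟩ := exists_run_sequential_start i₀ M₁ M₂ h₁ h₂ hw ht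
  obtain ⟨s', hs', h'⟩ := exists_iterate_step_run₂ h htape hs
  rw [run, ← Function.iterate_add_apply] at h'
  exact HaltsWith.mono (s := s' + (t' + ((L + 1) * w.length + 1))) h' (by omega)

end Sequential

end MultiTapeTM

/-! ### The machine for the word problem -/

theorem IsGeneratingFamily.exists_word {A G : Type*} [Group G] {π : A → G}
    (hπ : IsGeneratingFamily π) (g : G) :
    ∃ l : List (A × Bool), FreeGroup.lift π (FreeGroup.mk l) = g := by
  classical
  have hg : g ∈ (FreeGroup.lift π).range := by
    rw [FreeGroup.range_lift_eq_closure, hπ]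
    trivial
  obtain ⟨v, rfl⟩ := hg
  exact ⟨v.toWord, by rw [FreeGroup.mk_toWord]⟩

theorem mem_wordProblem {A G : Type*} [Group G] {π : A → G} {w : List (A × Bool)} :
    w ∈ wordProblem π ↔ FreeGroup.lift π (FreeGroup.mk w) = 1 := Iff.rfl

section Rewriting

variable {G : Type*} [Group G] {H : Subgroup G} [H.FiniteIndex] {Q : Type*} [Group Q]
  (φ : H →* Q) {A B₁ B₂ : Type*} (π : A → G) {ρ : B₁ → Q} (hρ : IsGeneratingFamily ρ)
  {σ : B₂ → G} (hσ : IsGeneratingFamily σ)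

/-- The transducer that follows the orbit of a point of the induced space: its states are the
cosets, and its outputs are words for the inverses of the fibre coordinate and of the element that
is read. -/
noncomputable def inducedTransducer : PrependTransducer (A × Bool) (B₁ × Bool) (B₂ × Bool) where
  State := Fin (Nat.card (G ⧸ H))
  finiteState := inferInstance
  next i s := Finite.equivFin (G ⧸ H) ((letterValue π s)⁻¹ • (Finite.equivFin (G ⧸ H)).symm i)
  out₁ i s := (hρ.exists_word
    (φ (cosetCocycle H (letterValue π s)⁻¹ ((Finite.equivFin (G ⧸ H)).symm i)))).choose
  out₂ _ s := (hσ.exists_word (letterValue π s)⁻¹).choose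

/-- The states of `inducedTransducer` are the cosets. -/
noncomputable def inducedTransducerState :
    (inducedTransducer φ π hρ hσ).State ≃ G ⧸ H :=
  (Finite.equivFin (G ⧸ H)).symm

theorem inducedTransducerState_next (c : (inducedTransducer φ π hρ hσ).State) (s : A × Bool) :
    inducedTransducerState φ π hρ hσ ((inducedTransducer φ π hρ hσ).next c s)
      = (letterValue π s)⁻¹ • inducedTransducerState φ π hρ hσ c :=
  Equiv.symm_apply_apply _ _

theorem lift_out₁_inducedTransducer (c : (inducedTransducer φ π hρ hσ).State) (s : A × Bool) :
    FreeGroup.lift ρ (FreeGroup.mk ((inducedTransducer φ π hρ hσ).out₁ c s))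
      = φ (cosetCocycle H (letterValue π s)⁻¹ (inducedTransducerState φ π hρ hσ c)) :=
  (hρ.exists_word _).choose_spec

theorem lift_out₂_inducedTransducer (c : (inducedTransducer φ π hρ hσ).State) (s : A × Bool) :
    FreeGroup.lift σ (FreeGroup.mk ((inducedTransducer φ π hρ hσ).out₂ c s))
      = (letterValue π s)⁻¹ :=
  (hσ.exists_word _).choose_spec

/-- Prepending multiplies on the left, whereas the action multiplies the fibre by inverses on the
right; hence the outputs track inverses. This is harmless, as an element is trivial exactly when its
inverse is. -/
theorem inducedTransducer_eval (c : (inducedTransducer φ π hρ hσ).State) (w : List (A × Bool)) :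
    inducedTransducerState φ π hρ hσ ((inducedTransducer φ π hρ hσ).eval c w).1
      = (w.foldl (fun y s => (letterValue π s)⁻¹ • y)
          (⟨1, inducedTransducerState φ π hρ hσ c⟩ : InducedSpace φ)).base ∧
    FreeGroup.lift ρ (FreeGroup.mk ((inducedTransducer φ π hρ hσ).eval c w).2.1)
      = (w.foldl (fun y s => (letterValue π s)⁻¹ • y)
          (⟨1, inducedTransducerState φ π hρ hσ c⟩ : InducedSpace φ)).fiber⁻¹ ∧
    FreeGroup.lift σ (FreeGroup.mk ((inducedTransducer φ π hρ hσ).eval c w).2.2)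
      = (FreeGroup.lift π (FreeGroup.mk w))⁻¹ := by
  induction w using List.reverseRecOn with
  | nil => simp [PrependTransducer.eval, ← FreeGroup.one_eq_mk]
  | append_singleton w s ih =>
    obtain ⟨ih1, ih2, ih3⟩ := ih
    rw [PrependTransducer.eval_append_singleton, List.foldl_append, List.foldl_cons,
      List.foldl_nil, InducedSpace.smul_def]
    simp only [PrependTransducer.stepOn]
    refine ⟨?_, ?_, ?_⟩
    · rw [inducedTransducerState_next, ih1]
    · rw [← FreeGroup.mul_mk, map_mul, ih2, mul_inv_rev, inv_inv, ← ih1,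
        lift_out₁_inducedTransducer]
    · rw [← FreeGroup.mul_mk, map_mul, ih3, ← FreeGroup.mul_mk, map_mul, mul_inv_rev,
        lift_out₂_inducedTransducer, letterValue]

theorem foldl_letterValue_eq_iff (c : (inducedTransducer φ π hρ hσ).State)
    (w : List (A × Bool)) :
    w.foldl (fun y s => (letterValue π s)⁻¹ • y)
        (⟨1, inducedTransducerState φ π hρ hσ c⟩ : InducedSpace φ)
          = ⟨1, inducedTransducerState φ π hρ hσ c⟩ ↔
      ((inducedTransducer φ π hρ hσ).eval c w).1 = c ∧
      ((inducedTransducer φ π hρ hσ).eval c w).2.1 ∈ wordProblem ρ := by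
  obtain ⟨h1, h2, -⟩ := inducedTransducer_eval φ π hρ hσ c w
  rw [mem_wordProblem, h2, inv_eq_one, InducedSpace.ext_iff, ← h1, EmbeddingLike.apply_eq_iff_eq]
  exact and_comm

theorem inducedTransducer_eval_mem_wordProblem_iff (c : (inducedTransducer φ π hρ hσ).State)
    (w : List (A × Bool)) :
    ((inducedTransducer φ π hρ hσ).eval c w).2.2 ∈ wordProblem σ ↔ w ∈ wordProblem π := by
  obtain ⟨-, -, h3⟩ := inducedTransducer_eval φ π hρ hσ c w
  rw [mem_wordProblem, h3, inv_eq_one, mem_wordProblem]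

theorem exists_length_out_inducedTransducer_le [Finite A] :
    ∃ L, (∀ i s, ((inducedTransducer φ π hρ hσ).out₁ i s).length ≤ L) ∧
      ∀ i s, ((inducedTransducer φ π hρ hσ).out₂ i s).length ≤ L := by
  set D := inducedTransducer φ π hρ hσ
  have := D.finiteState
  obtain ⟨L, hL⟩ := (Set.finite_range fun p : D.State × (A × Bool) =>
    (D.out₁ p.1 p.2).length + (D.out₂ p.1 p.2).length).bddAbove
  exact ⟨L, fun i s => (Nat.le_add_right _ _).trans (hL ⟨(i, s), rfl⟩),
    fun i s => (Nat.le_add_left _ _).trans (hL ⟨(i, s), rfl⟩)⟩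

open Classical in
/-- A machine for the word problem of `G` which first tries to refute that a word represents the
identity by the action on the induced space, and solves the word problem of `G` by brute force only
if this fails. -/
theorem exists_decides_wordProblem [Finite A] (hρ : IsGeneratingFamily ρ)
    (hσ : IsGeneratingFamily σ) (i : G ⧸ H) {M₁ : MultiTapeTM (B₁ × Bool)}
    (hM₁ : M₁.Decides (wordProblem ρ)) {f : ℕ → ℕ} (hf : Monotone f) (hfle : ∀ n, n ≤ f n)
    (hf₁ : ∀ w, M₁.time w ≤ (f w.length : ℕ∞)) {M₂ : MultiTapeTM (B₂ × Bool)}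
    (hM₂ : M₂.Decides (wordProblem σ)) :
    ∃ (M : MultiTapeTM (A × Bool)) (L : ℕ), M.Decides (wordProblem π) ∧
      ∀ w, ∃ w₂ : List (B₂ × Bool), w₂.length ≤ L * w.length ∧
        M.time w ≤ ((L + 2) * f ((L + 2) * w.length + (L + 2)) + (L + 2) : ℕ) +
          if w.foldl (fun y s => (letterValue π s)⁻¹ • y) (⟨1, i⟩ : InducedSpace φ) = ⟨1, i⟩
          then M₂.time w₂ else 0 := by
  obtain ⟨L, hL₁, hL₂⟩ := exists_length_out_inducedTransducer_le φ π hρ hσ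
  obtain ⟨i₀, rfl⟩ := (inducedTransducerState φ π hρ hσ).surjective i
  have hlen := (inducedTransducer φ π hρ hσ).length_eval_le hL₁ hL₂ i₀
  have hfix := foldl_letterValue_eq_iff φ π hρ hσ i₀
  have hmem := inducedTransducer_eval_mem_wordProblem_iff φ π hρ hσ i₀
  generalize inducedTransducerState φ π hρ hσ i₀ = i at hfix ⊢
  generalize inducedTransducer φ π hρ hσ = D at *
  -- This makes early rejection sound.
  have hmove : ∀ w ∈ wordProblem π,
      w.foldl (fun y s => (letterValue π s)⁻¹ • y) (⟨1, i⟩ : InducedSpace φ) = ⟨1, i⟩ := by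
    intro w hw
    rw [foldl_letterValue_smul, show FreeGroup.lift π (FreeGroup.mk w) = 1 from hw, inv_one,
      one_smul]
  -- The linear cost of transducing is absorbed by `n ≤ f n`, which leaves the closure form of
  -- `IsTimeFamily` with constant `L + 2`.
  have hbound : ∀ n t : ℕ, t ≤ f (L * n) →
      (L + 1) * n + 1 + t ≤ (L + 2) * f ((L + 2) * n + (L + 2)) + (L + 2) := by
    intro n t ht
    have h1 : (L + 2) * n + (L + 2) ≤ f ((L + 2) * n + (L + 2)) := hfle _
    have h2 : f (L * n) ≤ f ((L + 2) * n + (L + 2)) := hf (by nlinarith)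
    nlinarith [Nat.zero_le (L * f ((L + 2) * n + (L + 2)))]
  have key : ∀ w, ∃ t : ℕ, (MultiTapeTM.sequential D i₀ L M₁ M₂).HaltsWith w
      (decide (w ∈ wordProblem π)) t ∧
      (t : ℕ∞) ≤ ((L + 2) * f ((L + 2) * w.length + (L + 2)) + (L + 2) : ℕ) +
        if w.foldl (fun y s => (letterValue π s)⁻¹ • y) (⟨1, i⟩ : InducedSpace φ) = ⟨1, i⟩
        then M₂.time (D.eval i₀ w).2.2 else 0 := by
    intro w
    by_cases hw : (D.eval i₀ w).1 = i₀
    · obtain ⟨t₁, ht₁, hM₁w⟩ := hM₁.exists_time_eq (D.eval i₀ w).2.1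
      have ht₁f : t₁ ≤ f (L * w.length) := by
        have h := hf₁ (D.eval i₀ w).2.1
        rw [ht₁] at h
        exact (by exact_mod_cast h : t₁ ≤ _).trans (hf (hlen w).1)
      by_cases hw₁ : (D.eval i₀ w).2.1 ∈ wordProblem ρ
      · obtain ⟨t₂, ht₂, hM₂w⟩ := hM₂.exists_time_eq (D.eval i₀ w).2.2
        rw [decide_eq_true hw₁] at hM₁w
        refine ⟨(L + 1) * w.length + 1 + t₁ + t₂, ?_, ?_⟩
        · have := MultiTapeTM.haltsWith_sequential_of_accept i₀ M₁ M₂ hL₁ hL₂ hw hM₁w hM₂w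
          rwa [decide_eq_decide.2 (hmem w)] at this
        · rw [if_pos ((hfix w).2 ⟨hw, hw₁⟩), ht₂]
          exact_mod_cast Nat.add_le_add_right (hbound w.length t₁ ht₁f) t₂
      · rw [decide_eq_false hw₁] at hM₁w
        have hne := fun h => hw₁ ((hfix w).1 h).2
        rw [if_neg hne, decide_eq_false fun h => hne (hmove w h), add_zero]
        exact ⟨_, MultiTapeTM.haltsWith_sequential_of_reject i₀ M₁ M₂ hL₁ hL₂ hw hM₁w,
          by exact_mod_cast hbound w.length t₁ ht₁f⟩
    · have hne := fun h => hw ((hfix w).1 h).1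
      rw [if_neg hne, decide_eq_false fun h => hne (hmove w h), add_zero]
      exact ⟨_, MultiTapeTM.haltsWith_sequential_of_ne i₀ M₁ M₂ hL₁ hL₂ hw,
        by exact_mod_cast hbound w.length 0 (Nat.zero_le _)⟩
  refine ⟨MultiTapeTM.sequential D i₀ L M₁ M₂, L, fun w => ?_, fun w => ?_⟩
  · obtain ⟨t, ht, -⟩ := key w
    exact ⟨fun hw => ⟨t, by rwa [decide_eq_true hw] at ht⟩,
      fun hw => ⟨t, by rwa [decide_eq_false hw] at ht⟩⟩
  · obtain ⟨t, ht, hle⟩ := key w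
    exact ⟨_, (hlen w).2, ht.time_le.trans hle⟩

end Rewriting

/-! ### The average-case bound. -/

theorem theoremE {G : Type*} [Group G] [Group.IsFinitelyPresented G]
    (hG : HasWordProblemIn G SubExp)
    (𝓕 : Set (ℕ → ℕ)) (h𝓕 : IsTimeFamily 𝓕) (h𝓕_subExp : DTime 𝓕 ≤ SubExp)
    (H : Subgroup G) [H.FiniteIndex]
    {Q : Type*} [Group Q] (φ : H →* Q) (hφ : Function.Surjective φ)
    (hQ : ¬ IsAmenableGroup Q) (hQ_word : HasWordProblemIn Q (DTime 𝓕))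
    {A : Type*} [Finite A] [DecidableEq A] (π : A → G) (hπ : IsGeneratingFamily π) :
    ∃ M : MultiTapeTM (A × Bool), ∃ f ∈ 𝓕,
      M.SolvesOnAverage (wordProblem π) f {μ | IsLengthInvariant μ} := by
  classical
  have := Fintype.ofFinite A
  obtain ⟨n, σ, hσ, g, hg, M₂, hM₂, hg₂⟩ := hG
  obtain ⟨m, ρ, hρ, f, hf, M₁, hM₁, hf₁⟩ := hQ_word
  set i : G ⧸ H := ((1 : G) : G ⧸ H)
  obtain ⟨C, r, hC, hr0, hr1, hcard⟩ := exists_card_stabilizer_le φ hφ hQ hπ ⟨1, i⟩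
  obtain ⟨M, L, hM, htime⟩ := exists_decides_wordProblem φ π hρ hσ i hM₁ (h𝓕.monotone f hf)
    (h𝓕.le_self f hf) hf₁ hM₂
  -- The base `r⁻¹` is chosen to cancel the decay `r ^ n` of the proportion of slow words.
  obtain ⟨K, hK⟩ := hg.exists_le_mul_pow (one_lt_inv₀ hr0 |>.2 hr1) L
  set p : List (A × Bool) → Prop := fun w =>
    w.foldl (fun y s => (letterValue π s)⁻¹ • y) (⟨1, i⟩ : InducedSpace φ) = ⟨1, i⟩ with hp
  set F : ℕ → ℕ := fun n => (L + 2) * f ((L + 2) * n + (L + 2)) + (L + 2) with hF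
  have hF𝓕 : F ∈ 𝓕 := h𝓕.closed f hf (L + 2) (by omega)
  have hF0 : ∀ n, 0 < F n := fun n => by positivity
  set b : ℕ → ℝ≥0∞ := fun n => ENNReal.ofReal (K * r⁻¹ ^ n) with hb
  have hT : ∀ w, (M.time w : ℝ≥0∞) ≤ F w.length + if p w then b w.length else 0 := by
    intro w
    obtain ⟨w₂, hw₂, h⟩ := htime w
    have h' : (M.time w : ℝ≥0∞) ≤ ((F w.length : ℕ∞) + if p w then M₂.time w₂ else 0 : ℕ∞) :=
      ENat.toENNReal_le.2 h
    refine h'.trans ?_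
    rw [ENat.toENNReal_add, ENat.toENNReal_coe]
    gcongr
    split_ifs
    · refine (hg₂ w₂).trans ?_
      rw [hb, ← ENNReal.ofReal_coe_nnreal]
      exact ENNReal.ofReal_le_ofReal (hK _ _ hw₂)
    · simp
  -- The 1 pays for the fast test, and `C * K` for the slow words, whose cost is not even reduced by
  -- dividing by `F ≥ 1`.
  refine ⟨M, F, hF𝓕, hM, h𝓕.monotone F hF𝓕, hF0, 1 + C.toNNReal * K, by positivity,
    fun μ hμ => ?_⟩
  have hmean : ∀ n, ((reducedWords A n).filter p).card * b n
      ≤ ENNReal.ofReal (C * K) * (reducedWords A n).card := by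
    intro n
    rw [hb, ← ENNReal.ofReal_natCast, ← ENNReal.ofReal_natCast,
      ← ENNReal.ofReal_mul (by positivity), ← ENNReal.ofReal_mul (by positivity)]
    refine ENNReal.ofReal_le_ofReal ?_
    calc _ ≤ C * r ^ n * (reducedWords A n).card * (K * r⁻¹ ^ n) := by
          gcongr
          exact hcard n
      _ = C * K * (reducedWords A n).card * (r * r⁻¹) ^ n := by rw [mul_pow]; ring
      _ = _ := by rw [mul_inv_cancel₀ hr0.ne', one_pow, mul_one]
  calc ∑' v : FreeGroup A, (M.time v.toWord : ℝ≥0∞) / (F v.norm : ℝ≥0∞) * μ v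
      ≤ ∑' v : FreeGroup A, (μ v + (if p v.toWord then b v.norm else 0) * μ v) := by
        refine ENNReal.tsum_le_tsum fun v => ?_
        rw [← one_add_mul]
        gcongr
        refine ENNReal.div_le_of_le_mul ((hT v.toWord).trans ?_)
        have h1 : (1 : ℝ≥0∞) ≤ F v.norm := by exact_mod_cast hF0 v.norm
        rw [add_mul, one_mul]
        gcongr
        · exact le_rfl
        · exact le_mul_of_one_le_right' h1
    _ = 1 + ∑' v : FreeGroup A, (if p v.toWord then b v.norm else 0) * μ v := by
        rw [ENNReal.tsum_add, μ.tsum_coe]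
    _ ≤ 1 + ENNReal.ofReal (C * K) := by
        gcongr
        exact tsum_mul_le_of_isLengthInvariant hμ p b hmean
    _ = _ := by
        rw [ENNReal.ofReal_mul hC.le, ENNReal.ofReal_coe_nnreal]
        push_cast
        rfl
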